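/- **Theorem (transient frequency safety).** Consider $N\ge 1$ control areas $\mathcal N=\{1,\dots,N\}$ joined by tie-lines forming a connected graph; $\mathcal N_i$ is the set of neighbours of $i$. Let $M_i,D_i,a_{g,i},b_{g,i},\beta_i>0$, $B_{ij}=B_{ji}>0$ for every tie-line, $d_i,\underline P_{g,i},\overline P_{g,i}\in\mathbb R$, and $\underline w_i<0<\overline w_i$. The state is $z=(\alpha,w,P_g^r,\xi)\in\mathbb R^{N-1}\times\mathbb R^N\times\prod_i[\underline P_{g,i},\overline P_{g,i}]\times\mathbb R^N$, and $\alpha_N:=0$. Put $\varphi_i=\sum_{j\in\mathcal N_i}B_{ij}(\alpha_i-\alpha_j)$, $$\tilde l_i=D_iw_i+d_i+\varphi_i+\beta_iM_i(\underline w_i-w_i),\qquad \tilde u_i=D_iw_i+d_i+\varphi_i-\beta_iM_i(w_i-\overline w_i),$$ $$P_{g,i}=\min\{\max\{P^r_{g,i},\max\{\underline P_{g,i},\tilde l_i\}\},\min\{\overline P_{g,i},\tilde u_i\}\}.$$ The closed-loop system is $$\dot\alpha_i=w_i-w_N\ (i<N),\qquad M_i\dot w_i=-D_iw_i+P_{g,i}-d_i-\varphi_i,$$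 $$\dot P^r_{g,i}=[-a_{g,i}P^r_{g,i}-b_{g,i}-\xi_i-w_i]_{P^r_{g,i}-\underline P_{g,i}}^{\overline P_{g,i}-P^r_{g,i}},\qquad \dot\xi_i=P^r_{g,i}-d_i,$$ where $[u]_{x-\underline x}^{\overline x-x}=0$ if ($x=\underline x$ and $u\le0$) or ($x=\overline x$ and $u\ge0$), and $[u]_{x-\underline x}^{\overline x-x}=u$ otherwise. Let $T\in(0,\infty]$ and let $z$ be a Carathéodory solution on $[0,T)$ (state-set valued, absolutely continuous on compact subintervals, satisfying the system for almost every $t$). Assumption 1: for every $t\in[0,T)$ and every area $i$ the safety corrector problem of minimizing $\tfrac12(p-P^r_{g,i}(t))^2$ over $p$ subject to $\underline P_{g,i}\le p\le\overline P_{g,i}$ and $\tilde l_i(t)\le p\le\tilde u_i(t)$ has a feasible point. Suppose Assumption 1 holds. Then, for every area $i$: (a) If $w_i(0)\in[\underline w_i,\overline w_i]$, then $w_i(t)\in[\underline w_i,\overline w_i]$ for all $t\in(0,T)$. (b) If $w_i(0)\notin[\underline w_i,\overline w_i]$, then $w_i$ approaches the interval monotonically: the distance of $w_i(t)$ to $[\underline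 w_i,\overline w_i]$ is nonincreasing on $[0,T)$, and, on the set of times at which $w_i(t)\notin[\underline w_i,\overline w_i]$, the function $w_i$ is nonincreasing if $w_i(0)>\overline w_i$ and nondecreasing if $w_i(0)<\underline w_i$. If, moreover, $T=\infty$ and the steady-state dispatch problem, whose constraints are $P_{g,j}-d_j=0$ and $\underline P_{g,j}\le P_{g,j}\le\overline P_{g,j}$ for all $j\in\mathcal N$, is feasible, then there is a finite time $t_1>0$ such that $w_i(t)\in[\underline w_i,\overline w_i]$ for all $t\ge t_1$. -/

import Mathlib

open Set MeasureTheory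

noncomputable section

/-- Data of a power network with `n + 1` control areas, indexed by `Fin (n + 1)`; the last area is
the reference area for the angles. -/
structure PowerNetwork (n : ℕ) where
  /-- tie-lines -/
  graph : SimpleGraph (Fin (n + 1))
  graph_connected : graph.Connected
  /-- sensitivity of the line flow to the angle difference (used on tie-lines only) -/
  B : Fin (n + 1) → Fin (n + 1) → ℝ
  B_symm : ∀ i j, graph.Adj i j → B i j = B j i
  B_pos : ∀ i j, graph.Adj i j → 0 < B i j
  /-- inertia -/
  M : Fin (n + 1) → ℝ
  M_pos : ∀ i, 0 < M i
  /-- damping -/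
  D : Fin (n + 1) → ℝ
  D_pos : ∀ i, 0 < D i
  /-- net load -/
  d : Fin (n + 1) → ℝ
  /-- quadratic cost coefficient -/
  a : Fin (n + 1) → ℝ
  a_pos : ∀ i, 0 < a i
  /-- linear cost coefficient -/
  b : Fin (n + 1) → ℝ
  b_pos : ∀ i, 0 < b i
  /-- design parameter of the barrier condition -/
  β : Fin (n + 1) → ℝ
  β_pos : ∀ i, 0 < β i
  /-- lower and upper generation capacity -/
  Plo : Fin (n + 1) → ℝ
  Phi : Fin (n + 1) → ℝ
  /-- lower and upper safe frequency -/
  wlo : Fin (n + 1) → ℝ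
  wlo_neg : ∀ i, wlo i < 0
  whi : Fin (n + 1) → ℝ
  whi_pos : ∀ i, 0 < whi i

/-- State of the closed loop: reduced angles of all areas but the last, frequencies, generation
references, multipliers. -/
structure GridState (n : ℕ) where
  α : Fin n → ℝ
  w : Fin (n + 1) → ℝ
  Pr : Fin (n + 1) → ℝ
  ξ : Fin (n + 1) → ℝ

/-- The scalar projection operator `[u]` at the point `x` of the interval `[lo, hi]`. -/
def boxProj (lo hi x u : ℝ) : ℝ :=
  open Classical in
  if (x - lo = 0 ∧ u ≤ 0) ∨ (hi - x = 0 ∧ 0 ≤ u) then 0 else u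

/-- The times `0 ≤ t < T`, where `T` may be `⊤`. -/
def timeDomain (T : EReal) : Set ℝ := {t | 0 ≤ t ∧ (t : EReal) < T}

namespace PowerNetwork

variable {n : ℕ} (net : PowerNetwork n)

/-- The reduced angle of every area, with value `0` in the reference area. -/
def angle (z : GridState n) : Fin (n + 1) → ℝ := Fin.snoc (α := fun _ => ℝ) z.α 0

/-- Net tie-line power leaving area `i`. -/
def tiePower (z : GridState n) (i : Fin (n + 1)) : ℝ :=
  open Classical in
  ∑ j ∈ net.graph.neighborFinset i, net.B i j * (angle z i - angle z j)

/-- Lower bound on the generation coming from the barrier condition at the lower frequency limit. -/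
def lTilde (z : GridState n) (i : Fin (n + 1)) : ℝ :=
  net.D i * z.w i + net.d i + net.β i * net.M i * (net.wlo i - z.w i) + net.tiePower z i

/-- Upper bound on the generation coming from the barrier condition at the upper frequency limit. -/
def uTilde (z : GridState n) (i : Fin (n + 1)) : ℝ :=
  net.D i * z.w i + net.d i - net.β i * net.M i * (z.w i - net.whi i) + net.tiePower z i

/-- Feasible set of the safety corrector problem of area `i` in state `z`. -/
def correctorFeasibleSet (z : GridState n) (i : Fin (n + 1)) : Set ℝ :=
  {p | net.Plo i ≤ p ∧ p ≤ net.Phi i ∧ net.lTilde z i ≤ p ∧ p ≤ net.uTilde z i}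

/-- The generation produced by the safety corrector. -/
def Pg (z : GridState n) (i : Fin (n + 1)) : ℝ :=
  min (max (z.Pr i) (max (net.Plo i) (net.lTilde z i))) (min (net.Phi i) (net.uTilde z i))

/-- The set of admissible states: the references respect the capacity limits. -/
def stateSet : Set (GridState n) := {z | ∀ i, net.Plo i ≤ z.Pr i ∧ z.Pr i ≤ net.Phi i}

/-- Right-hand side of the closed-loop system. -/
def field (z : GridState n) : GridState n where
  α := fun k => z.w k.castSucc - z.w (Fin.last n)
  w := fun i => (net.M i)⁻¹ * (-net.D i * z.w i + net.Pg z i - net.d i - net.tiePower z i)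
  Pr := fun i => boxProj (net.Plo i) (net.Phi i) (z.Pr i)
    (-net.a i * z.Pr i - net.b i - z.ξ i - z.w i)
  ξ := fun i => z.Pr i - net.d i

/-- `z` is a Carathéodory solution of the closed-loop system on `[0, T)`: it takes admissible
values, is absolutely continuous on compact subintervals, and satisfies the system at almost every
time. -/
structure IsCaratheodorySolution (T : EReal) (z : ℝ → GridState n) : Prop where
  mem : ∀ t ∈ timeDomain T, z t ∈ net.stateSet
  ac_α : ∀ k, ∀ t ∈ timeDomain T, AbsolutelyContinuousOnInterval (fun s => (z s).α k) 0 t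
  ac_w : ∀ i, ∀ t ∈ timeDomain T, AbsolutelyContinuousOnInterval (fun s => (z s).w i) 0 t
  ac_Pr : ∀ i, ∀ t ∈ timeDomain T, AbsolutelyContinuousOnInterval (fun s => (z s).Pr i) 0 t
  ac_ξ : ∀ i, ∀ t ∈ timeDomain T, AbsolutelyContinuousOnInterval (fun s => (z s).ξ i) 0 t
  deriv_ae : ∀ᵐ t : ℝ, t ∈ timeDomain T →
    (∀ k, HasDerivAt (fun s => (z s).α k) ((net.field (z t)).α k) t) ∧
    (∀ i, HasDerivAt (fun s => (z s).w i) ((net.field (z t)).w i) t) ∧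
    (∀ i, HasDerivAt (fun s => (z s).Pr i) ((net.field (z t)).Pr i) t) ∧
    (∀ i, HasDerivAt (fun s => (z s).ξ i) ((net.field (z t)).ξ i) t)

/-- The safety corrector problem of every area is feasible at all times of `[0, T)`. -/
def CorrectorFeasibleAlong (T : EReal) (z : ℝ → GridState n) : Prop :=
  ∀ t ∈ timeDomain T, ∀ i, (net.correctorFeasibleSet (z t) i).Nonempty

/-- The steady-state generation dispatch problem (balance `P i = d i` and capacity limits in every
area) has a feasible point. -/
def DispatchFeasible : Prop :=
  ∃ P : Fin (n + 1) → ℝ, (∀ i, P i - net.d i = 0) ∧ ∀ i, net.Plo i ≤ P i ∧ P i ≤ net.Phi i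

/-- The interval of safe frequencies of area `i`. -/
def safeSet (i : Fin (n + 1)) : Set ℝ := Icc (net.wlo i) (net.whi i)

end PowerNetwork

end

/-! Invariance and monotone approach are barrier arguments. Feasibility of the corrector keeps `Pg`
between `lTilde` and `uTilde`, so almost everywhere the acceleration `v i` of area `i` (the
`w`-component of `field`) satisfies `β (wlo - w) ≤ v ≤ β (whi - w)`. Hence `w` cannot increase above
`whi` or decrease below `wlo`, and the comparison lemma `le_max_of_deriv_nonpos` gives everything
except finite-time entry.

The barrier alone yields only exponential approach, so entry in finite time needs a global argument.
Let `c = Pr - Pg` be the curtailment. When `c ≠ 0` a barrier inequality is an equality, so `v' = -β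
v` there, and `-v c` is at most an exponentially decaying term. The function `E` in
`exists_integral_sq_le`, built from the kinetic energy of the accelerations, the power `v c`, that
exponential term and the potential energy of the frequency differences, then satisfies `E' ≤ ∑ (v
Pr' - D v²)`. The projected controller is incrementally passive, which bounds `∫ v Pr'` from above;
therefore every acceleration is square integrable.

Feasibility also bounds tie-line powers and hence, by connectedness, the angles. Differentiating
(angle difference) × (frequency difference) then shows that the frequencies synchronize in the mean
(`isMeanNull_w_sub`).

Finally, `∑ (ξ - M w)` is bounded when the dispatch is feasible, and its derivative is `∑ (D w +
c)`, since tie-line powers sum to zero. If some `w i` stayed above `whi i > 0`, synchronization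
would make `∑ D w` positive in the mean, while a negative `c j` forces `w j` away from `w i` or `v
j` away from zero, which is rare in the mean. The bounded quantity would grow linearly: a
contradiction. The lower limit is symmetric, and once both limits have been met invariance finishes
the proof. -/

/-! ### Absolutely continuous functions: closure properties and comparison. -/

theorem AbsolutelyContinuousOnInterval.mono_Icc {f : ℝ → ℝ} {a b c d : ℝ}
    (hf : AbsolutelyContinuousOnInterval f a b) (hac : a ≤ c) (hcd : c ≤ d) (hdb : d ≤ b) :
    AbsolutelyContinuousOnInterval f c d := by
  refine hf.mono ?_
  rw [uIcc_of_le hcd, uIcc_of_le (hac.trans (hcd.trans hdb))]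
  exact Icc_subset_Icc hac hdb

theorem AbsolutelyContinuousOnInterval.const (c a b : ℝ) :
    AbsolutelyContinuousOnInterval (fun _ => c) a b :=
  contDiff_const.contDiffOn.absolutelyContinuousOnInterval

theorem AbsolutelyContinuousOnInterval.fun_sum {ι : Type*} (s : Finset ι) {f : ι → ℝ → ℝ}
    {a b : ℝ} (hf : ∀ i ∈ s, AbsolutelyContinuousOnInterval (f i) a b) :
    AbsolutelyContinuousOnInterval (fun t => ∑ i ∈ s, f i t) a b := by
  classical
  induction s using Finset.induction_on with
  | empty => simpa using AbsolutelyContinuousOnInterval.const 0 a b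
  | insert i s hi ih =>
    simp only [Finset.sum_insert hi]
    exact (hf i (by simp)).fun_add (ih fun j hj => hf j (by simp [hj]))

/-- The increment sums of `h` are squeezed by those of `f` and `g`. This covers `min` and `max`,
hence the nonsmooth formula for `Pg`. -/
theorem AbsolutelyContinuousOnInterval.of_dist_le {f g h : ℝ → ℝ} {a b : ℝ}
    (hf : AbsolutelyContinuousOnInterval f a b) (hg : AbsolutelyContinuousOnInterval g a b)
    (hle : ∀ s t, dist (h s) (h t) ≤ dist (f s) (f t) + dist (g s) (g t)) :
    AbsolutelyContinuousOnInterval h a b := by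
  refine squeeze_zero (fun t => Finset.sum_nonneg fun i _ => dist_nonneg) (fun t => ?_)
    (by simpa using Filter.Tendsto.add hf hg)
  rw [← Finset.sum_add_distrib]
  exact Finset.sum_le_sum fun i _ => hle _ _

theorem AbsolutelyContinuousOnInterval.fun_max {f g : ℝ → ℝ} {a b : ℝ}
    (hf : AbsolutelyContinuousOnInterval f a b) (hg : AbsolutelyContinuousOnInterval g a b) :
    AbsolutelyContinuousOnInterval (fun t => max (f t) (g t)) a b :=
  hf.of_dist_le hg fun _ _ => (abs_max_sub_max_le_max _ _ _ _).trans
    (max_le (le_add_of_nonneg_right (abs_nonneg _)) (le_add_of_nonneg_left (abs_nonneg _)))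

theorem AbsolutelyContinuousOnInterval.fun_min {f g : ℝ → ℝ} {a b : ℝ}
    (hf : AbsolutelyContinuousOnInterval f a b) (hg : AbsolutelyContinuousOnInterval g a b) :
    AbsolutelyContinuousOnInterval (fun t => min (f t) (g t)) a b :=
  hf.of_dist_le hg fun _ _ => (abs_min_sub_min_le_max _ _ _ _).trans
    (max_le (le_add_of_nonneg_right (abs_nonneg _)) (le_add_of_nonneg_left (abs_nonneg _)))

theorem AbsolutelyContinuousOnInterval.comp_add_right {f : ℝ → ℝ} {a b h : ℝ}
    (hf : AbsolutelyContinuousOnInterval f (a + h) (b + h)) :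
    AbsolutelyContinuousOnInterval (fun t => f (t + h)) a b := by
  rw [absolutelyContinuousOnInterval_iff] at hf ⊢
  intro ε hε
  obtain ⟨δ, hδ, H⟩ := hf ε hε
  refine ⟨δ, hδ, fun E hE hsum => ?_⟩
  refine H (E.1, fun k => ((E.2 k).1 + h, (E.2 k).2 + h)) ⟨?_, ?_⟩ (by simpa using hsum)
  · intro k hk
    have := hE.1 k hk
    simp only [mem_uIcc] at this ⊢
    grind
  · intro k hk l hl hkl
    have := hE.2 hk hl hkl
    simp only [Function.onFun] at this ⊢
    rw [Set.disjoint_left] at this ⊢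
    intro x hx hx'
    refine @this (x - h) ?_ ?_
    · simp only [mem_uIoc] at hx ⊢; grind
    · simp only [mem_uIoc] at hx' ⊢; grind

/-- An absolutely continuous function grows by at most the integral of an almost everywhere upper
bound of its derivative. -/
theorem AbsolutelyContinuousOnInterval.sub_le_integral {f g : ℝ → ℝ} {a b : ℝ} (hab : a ≤ b)
    (hf : AbsolutelyContinuousOnInterval f a b) (hg : IntervalIntegrable g volume a b)
    (h : ∀ᵐ t : ℝ, t ∈ Icc a b → ∃ d ≤ g t, HasDerivAt f d t) :
    f b - f a ≤ ∫ t in a..b, g t := by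
  rw [← hf.integral_deriv_eq_sub]
  simp only [intervalIntegral.integral_of_le hab]
  refine setIntegral_mono_ae_restrict hf.intervalIntegrable_deriv.1 hg.1 ?_
  rw [Filter.EventuallyLE, ae_restrict_iff' measurableSet_Ioc]
  filter_upwards [h] with t ht hmem
  obtain ⟨d, hd, hd'⟩ := ht (Ioc_subset_Icc_self hmem)
  rwa [hd'.deriv]

theorem AbsolutelyContinuousOnInterval.le_of_deriv_nonpos {f : ℝ → ℝ} {a b : ℝ} (hab : a ≤ b)
    (hf : AbsolutelyContinuousOnInterval f a b)
    (h : ∀ᵐ t : ℝ, t ∈ Icc a b → ∃ d ≤ 0, HasDerivAt f d t) : f b ≤ f a := by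
  simpa using hf.sub_le_integral hab (g := fun _ => 0) (by simp) h

theorem AbsolutelyContinuousOnInterval.abs_sub_le {f : ℝ → ℝ} {a b C : ℝ} (hab : a ≤ b)
    (hf : AbsolutelyContinuousOnInterval f a b)
    (h : ∀ᵐ t : ℝ, t ∈ Icc a b → ∃ d, |d| ≤ C ∧ HasDerivAt f d t) :
    |f b - f a| ≤ C * (b - a) := by
  have h1 := hf.sub_le_integral hab (g := fun _ => C) (by simp) (by
    filter_upwards [h] with t ht hm
    obtain ⟨d, hd, hd'⟩ := ht hm
    exact ⟨d, (le_abs_self d).trans hd, hd'⟩)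
  have h2 := hf.fun_neg.sub_le_integral hab (g := fun _ => C) (by simp) (by
    filter_upwards [h] with t ht hm
    obtain ⟨d, hd, hd'⟩ := ht hm
    exact ⟨-d, (neg_le_abs d).trans hd, hd'.neg⟩)
  simp only [intervalIntegral.integral_const, smul_eq_mul] at h1 h2
  rw [abs_le]
  constructor <;> linarith

/-- An absolutely continuous function that is nonincreasing wherever it exceeds `K` stays below the
maximum of `K` and its initial value. -/
theorem AbsolutelyContinuousOnInterval.le_max_of_deriv_nonpos {f : ℝ → ℝ} {a b K : ℝ}
    (hab : a ≤ b) (hf : AbsolutelyContinuousOnInterval f a b)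
    (h : ∀ᵐ t : ℝ, t ∈ Icc a b → K < f t → ∃ d ≤ 0, HasDerivAt f d t) :
    f b ≤ max (f a) K := by
  by_contra! hlt
  have hc : ContinuousOn f (Icc a b) := by simpa [uIcc_of_le hab] using hf.continuousOn
  -- The last time `r` in `S` is the point after which `f` stays above `max (f a) K`.
  set S := Icc a b ∩ f ⁻¹' Iic (max (f a) K) with hS
  have hcl : IsClosed S := hc.preimage_isClosed_of_isClosed isClosed_Icc isClosed_Iic
  have hne : S.Nonempty := ⟨a, ⟨le_rfl, hab⟩, le_max_left (f a) K⟩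
  have hbdd : BddAbove S := ⟨b, fun x hx => hx.1.2⟩
  obtain ⟨hr, hr'⟩ := hcl.csSup_mem hne hbdd
  set r := sSup S
  have hout : ∀ t ∈ Ioc r b, max (f a) K < f t := by
    intro t ht
    by_contra! hle
    exact ht.1.not_ge (le_csSup hbdd ⟨⟨hr.1.trans ht.1.le, ht.2⟩, hle⟩)
  have := (hf.mono_Icc hr.1 hr.2 le_rfl).le_of_deriv_nonpos hr.2 (by
    -- At `r` itself `f` need not exceed `K`; a single point is negligible.
    filter_upwards [h, (Measure.ae_ne volume r)] with t ht hne hm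
    exact ht ⟨hr.1.trans hm.1, hm.2⟩
      ((le_max_right _ _).trans_lt (hout t ⟨lt_of_le_of_ne hm.1 hne.symm, hm.2⟩)))
  exact absurd (this.trans hr') hlt.not_ge

/-! ### Functions on the half-line whose absolute value has vanishing mean. -/

theorem continuousOn_Ici_of_absolutelyContinuousOnInterval {f : ℝ → ℝ}
    (hf : ∀ t, 0 ≤ t → AbsolutelyContinuousOnInterval f 0 t) : ContinuousOn f (Ici 0) := by
  intro t ht
  have h := (hf (t + 1) (by linarith [mem_Ici.1 ht])).continuousOn
  rw [uIcc_of_le (by linarith [mem_Ici.1 ht])] at h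
  refine (h t ⟨ht, by linarith⟩).mono_of_mem_nhdsWithin ?_
  filter_upwards [self_mem_nhdsWithin, mem_nhdsWithin_of_mem_nhds (Iio_mem_nhds (lt_add_one t))]
    with s hs hs'
  exact ⟨hs, le_of_lt hs'⟩

theorem ContinuousOn.intervalIntegrable_of_Ici {f : ℝ → ℝ} (hf : ContinuousOn f (Ici 0)) {t : ℝ}
    (ht : 0 ≤ t) : IntervalIntegrable f volume 0 t :=
  (hf.mono (by rw [uIcc_of_le ht]; exact Icc_subset_Ici_self)).intervalIntegrable

/-- The integral of `|f|` over `[0, t]` is `o(t)`. -/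
def IsMeanNull (f : ℝ → ℝ) : Prop :=
  ContinuousOn f (Ici 0) ∧ ∀ δ > 0, ∃ K, ∀ t, 0 ≤ t → ∫ s in (0)..t, |f s| ≤ K + δ * t

namespace IsMeanNull

variable {f g : ℝ → ℝ}

theorem of_integral_le (hc : ContinuousOn f (Ici 0)) {K : ℝ}
    (h : ∀ t, 0 ≤ t → ∫ s in (0)..t, |f s| ≤ K) : IsMeanNull f :=
  ⟨hc, fun δ hδ => ⟨K, fun t ht => (h t ht).trans (by nlinarith)⟩⟩

theorem integral_abs_le (hg : ContinuousOn g (Ici 0)) (hf : ContinuousOn f (Ici 0))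
    (h : ∀ t, 0 ≤ t → |f t| ≤ g t) {t : ℝ} (ht : 0 ≤ t) :
    ∫ s in (0)..t, |f s| ≤ ∫ s in (0)..t, g s :=
  intervalIntegral.integral_mono_on ht (hf.abs.intervalIntegrable_of_Ici ht)
    (hg.intervalIntegrable_of_Ici ht) fun s hs => h s hs.1

theorem add (hf : IsMeanNull f) (hg : IsMeanNull g) : IsMeanNull fun t => f t + g t := by
  refine ⟨hf.1.add hg.1, fun δ hδ => ?_⟩
  obtain ⟨K, hK⟩ := hf.2 (δ / 2) (by positivity)
  obtain ⟨L, hL⟩ := hg.2 (δ / 2) (by positivity)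
  refine ⟨K + L, fun t ht => ?_⟩
  have h1 := integral_abs_le (hf.1.abs.add hg.1.abs) (hf.1.add hg.1)
    (fun t _ => abs_add_le (f t) (g t)) ht
  simp only [Pi.add_apply] at h1
  rw [intervalIntegral.integral_add (hf.1.abs.intervalIntegrable_of_Ici ht)
    (hg.1.abs.intervalIntegrable_of_Ici ht)] at h1
  linarith [hK t ht, hL t ht]

theorem const_mul (c : ℝ) (hf : IsMeanNull f) : IsMeanNull fun t => c * f t := by
  refine ⟨continuousOn_const.mul hf.1, fun δ hδ => ?_⟩
  obtain ⟨K, hK⟩ := hf.2 (δ / (|c| + 1)) (by positivity)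
  refine ⟨|c| * K, fun t ht => ?_⟩
  simp only [abs_mul, intervalIntegral.integral_const_mul]
  refine (mul_le_mul_of_nonneg_left (hK t ht) (abs_nonneg c)).trans ?_
  have : |c| * (δ / (|c| + 1) * t) ≤ δ * t := by
    rw [show |c| * (δ / (|c| + 1) * t) = (|c| / (|c| + 1)) * (δ * t) by ring]
    refine mul_le_of_le_one_left (by positivity) ?_
    rw [div_le_one (by positivity)]; linarith
  linarith

theorem abs (hf : IsMeanNull f) : IsMeanNull fun t => |f t| :=
  ⟨hf.1.abs, by simpa using hf.2⟩

theorem sum {ι : Type*} (s : Finset ι) {F : ι → ℝ → ℝ} (hF : ∀ i ∈ s, IsMeanNull (F i)) :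
    IsMeanNull fun t => ∑ i ∈ s, F i t := by
  classical
  induction s using Finset.induction_on with
  | empty => exact of_integral_le (K := 0) (by simpa using continuousOn_const) (by simp)
  | insert i s hi ih =>
    simp only [Finset.sum_insert hi]
    exact (hF i (by simp)).add (ih fun j hj => hF j (by simp [hj]))

theorem of_sq (hc : ContinuousOn f (Ici 0)) (h : IsMeanNull fun t => f t ^ 2) : IsMeanNull f := by
  refine ⟨hc, fun δ hδ => ?_⟩
  -- The bound `|f| ≤ δ / 2 + f² / (2 δ)` is used below; tolerance `δ ^ 2` for the square makes the
  -- second term contribute another `δ / 2`.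
  obtain ⟨K, hK⟩ := h.2 (δ ^ 2) (by positivity)
  refine ⟨K / (2 * δ), fun t ht => ?_⟩
  have h1 := integral_abs_le (g := fun s => δ / 2 + (2 * δ)⁻¹ * f s ^ 2)
    (continuousOn_const.add (continuousOn_const.mul h.1)) hc (fun t _ => by
      have : δ / 2 + (2 * δ)⁻¹ * f t ^ 2 - |f t| = (2 * δ)⁻¹ * (δ - |f t|) ^ 2 := by
        rw [← sq_abs (f t)]; field_simp; ring
      have h2 : 0 ≤ (2 * δ)⁻¹ * (δ - |f t|) ^ 2 := by positivity
      linarith) ht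
  rw [intervalIntegral.integral_add (hf := by simp)
    (f := fun _ => δ / 2) (g := fun s => (2 * δ)⁻¹ * f s ^ 2)
    (hg := (continuousOn_const.mul h.1).intervalIntegrable_of_Ici ht),
    intervalIntegral.integral_const_mul] at h1
  have h3 := hK t ht
  simp only [abs_pow, sq_abs] at h3
  have h4 : (2 * δ)⁻¹ * ∫ s in (0)..t, f s ^ 2 ≤ (2 * δ)⁻¹ * (K + δ ^ 2 * t) := by gcongr
  have h5 : (2 * δ)⁻¹ * (K + δ ^ 2 * t) = K / (2 * δ) + δ / 2 * t := by field_simp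
  simp only [intervalIntegral.integral_const, smul_eq_mul] at h1
  linarith

/-- A mean-null function cannot drive linear growth. -/
theorem not_linear_le (hg : IsMeanNull g) {c K : ℝ} (hc : 0 < c)
    (h : ∀ t, 0 ≤ t → c * t ≤ K + ∫ s in (0)..t, g s) : False := by
  obtain ⟨L, hL⟩ := hg.2 (c / 2) (by positivity)
  have key : ∀ t, 0 ≤ t → c / 2 * t ≤ K + L := fun t ht => by
    have h1 : ∫ s in (0)..t, g s ≤ ∫ s in (0)..t, |g s| :=
      intervalIntegral.integral_mono_on ht (hg.1.intervalIntegrable_of_Ici ht)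
        (hg.1.abs.intervalIntegrable_of_Ici ht) fun s _ => le_abs_self _
    linarith [h t ht, hL t ht]
  have h2 := key (2 / c * (|K + L| + 1)) (by positivity)
  have h3 : c / 2 * (2 / c * (|K + L| + 1)) = |K + L| + 1 := by field_simp
  linarith [le_abs_self (K + L)]

end IsMeanNull

/-! ### The scalar projection operator. -/

theorem boxProj_eq_zero_or (lo hi x u : ℝ) :
    boxProj lo hi x u = u ∨ (boxProj lo hi x u = 0 ∧ x = lo ∧ u ≤ 0) ∨
      (boxProj lo hi x u = 0 ∧ x = hi ∧ 0 ≤ u) := by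
  unfold boxProj
  split_ifs with h
  · rcases h with h | h
    · exact Or.inr (Or.inl ⟨rfl, by linarith, h.2⟩)
    · exact Or.inr (Or.inr ⟨rfl, by linarith, h.2⟩)
  · exact Or.inl rfl

theorem abs_boxProj_le (lo hi x u : ℝ) : |boxProj lo hi x u| ≤ |u| := by
  rcases boxProj_eq_zero_or lo hi x u with h | h | h
  · rw [h]
  · rw [h.1, abs_zero]; exact abs_nonneg u
  · rw [h.1, abs_zero]; exact abs_nonneg u

/-- The correction made by the projection points into the interval. -/
theorem boxProj_mul_sub_le {lo hi x y : ℝ} (hy : y ∈ Icc lo hi) (u : ℝ) :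
    boxProj lo hi x u * (x - y) ≤ u * (x - y) := by
  rcases boxProj_eq_zero_or lo hi x u with h | ⟨h, rfl, hu⟩ | ⟨h, rfl, hu⟩
  · rw [h]
  · rw [h]; nlinarith [hy.1]
  · rw [h]; nlinarith [hy.2]

/-- Monotonicity of the projected dynamics. -/
theorem boxProj_sub_mul_sub_le {lo hi x y : ℝ} (hx : x ∈ Icc lo hi) (hy : y ∈ Icc lo hi)
    (u v : ℝ) :
    (boxProj lo hi x u - boxProj lo hi y v) * (x - y) ≤ (u - v) * (x - y) := by
  nlinarith [boxProj_mul_sub_le (x := x) hy u, boxProj_mul_sub_le (x := y) hx v]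

theorem neg_boxProj (lo hi x u : ℝ) : boxProj (-hi) (-lo) (-x) (-u) = -boxProj lo hi x u := by
  unfold boxProj
  have e : ((-x - -hi = 0 ∧ -u ≤ 0) ∨ (-lo - -x = 0 ∧ 0 ≤ -u)) ↔
      ((x - lo = 0 ∧ u ≤ 0) ∨ (hi - x = 0 ∧ 0 ≤ u)) := by
    constructor
    · rintro (h | h)
      · exact Or.inr ⟨by linarith, by linarith⟩
      · exact Or.inl ⟨by linarith, by linarith⟩
    · rintro (h | h)
      · exact Or.inr ⟨by linarith, by linarith⟩
      · exact Or.inl ⟨by linarith, by linarith⟩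
  simp only [e]
  split_ifs <;> simp

/-! ### Passivity and boundedness of the projected controller. -/

theorem ae_comp_add_right {P : ℝ → Prop} (h : ∀ᵐ t : ℝ, P t) (c : ℝ) : ∀ᵐ t : ℝ, P (t + c) :=
  (measurePreserving_add_right volume c).quasiMeasurePreserving.ae h

/-- A projected proportional-integral controller on `[0, ∞)` with input `w`: the reference `p` is
confined to `[lo, hi]` and `x` integrates the mismatch `p - d`. -/
structure IsProjectedController (lo hi a b d : ℝ) (p x w : ℝ → ℝ) : Prop where
  a_nonneg : 0 ≤ a
  mem : ∀ t, 0 ≤ t → p t ∈ Icc lo hi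
  ac_p : ∀ t, 0 ≤ t → AbsolutelyContinuousOnInterval p 0 t
  ac_x : ∀ t, 0 ≤ t → AbsolutelyContinuousOnInterval x 0 t
  ac_w : ∀ t, 0 ≤ t → AbsolutelyContinuousOnInterval w 0 t
  deriv_p : ∀ᵐ t : ℝ, 0 ≤ t →
    HasDerivAt p (boxProj lo hi (p t) (-a * p t - b - x t - w t)) t
  deriv_x : ∀ᵐ t : ℝ, 0 ≤ t → HasDerivAt x (p t - d) t

namespace IsProjectedController

variable {lo hi a b d : ℝ} {p x w v : ℝ → ℝ}

theorem lipschitz_p (h : IsProjectedController lo hi a b d p x w) (S : ℝ) :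
    ∃ C, ∀ s t, 0 ≤ s → s ≤ t → t ≤ S → |p t - p s| ≤ C * (t - s) := by
  have hcp := continuousOn_Ici_of_absolutelyContinuousOnInterval h.ac_p
  have hcx := continuousOn_Ici_of_absolutelyContinuousOnInterval h.ac_x
  have hcw := continuousOn_Ici_of_absolutelyContinuousOnInterval h.ac_w
  have hc : ContinuousOn (fun t => -a * p t - b - x t - w t) (Icc 0 S) :=
    ((((continuousOn_const.mul hcp).sub continuousOn_const).sub hcx).sub hcw).mono
      Icc_subset_Ici_self
  obtain ⟨C, hC⟩ := isCompact_Icc.exists_bound_of_continuousOn hc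
  refine ⟨C, fun s t hs hst ht => ?_⟩
  refine ((h.ac_p t (hs.trans hst)).mono_Icc hs hst le_rfl).abs_sub_le hst ?_
  filter_upwards [h.deriv_p] with r hr hm
  exact ⟨_, (abs_boxProj_le _ _ _ _).trans (hC r ⟨hs.trans hm.1, hm.2.trans ht⟩),
    hr (hs.trans hm.1)⟩

theorem lipschitz_x (h : IsProjectedController lo hi a b d p x w) :
    ∃ C, ∀ s t, 0 ≤ s → s ≤ t → |x t - x s| ≤ C * (t - s) := by
  refine ⟨max |lo - d| |hi - d|, fun s t hs hst => ?_⟩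
  refine ((h.ac_x t (hs.trans hst)).mono_Icc hs hst le_rfl).abs_sub_le hst ?_
  filter_upwards [h.deriv_x] with r hr hm
  refine ⟨_, ?_, hr (hs.trans hm.1)⟩
  have := h.mem r (hs.trans hm.1)
  exact abs_le_max_abs_abs (by linarith [this.1]) (by linarith [this.2])

/-- Incremental passivity of the controller. -/
theorem integral_increment_le (h : IsProjectedController lo hi a b d p x w) {c t : ℝ} (hc : 0 ≤ c)
    (ht : 0 ≤ t) :
    ∫ s in (0)..t, (w (s + c) - w s) * (p (s + c) - p s) ≤
      ((p c - p 0) ^ 2 + (x c - x 0) ^ 2) / 2 := by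
  have sh : ∀ {f : ℝ → ℝ}, (∀ t, 0 ≤ t → AbsolutelyContinuousOnInterval f 0 t) →
      AbsolutelyContinuousOnInterval (fun s => f (s + c) - f s) 0 t := fun {f} hf =>
    AbsolutelyContinuousOnInterval.fun_sub
      (((hf (t + c) (by linarith)).mono_Icc (by linarith) (by linarith) le_rfl).comp_add_right)
      (hf t ht)
  have hp := sh h.ac_p
  have hx := sh h.ac_x
  have hw := sh h.ac_w
  -- Storage function: half the squared increments of `p` and `x` under the shift by `c`. In its
  -- derivative the cross terms between the two increments cancel, and the projection and `a ≥ 0`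
  -- only help.
  have hR := ((hp.fun_mul hp).fun_add (hx.fun_mul hx)).const_mul (1 / 2)
  have key := hR.sub_le_integral ht
    (g := fun s => -((w (s + c) - w s) * (p (s + c) - p s)))
    (hw.fun_mul hp).fun_neg.continuousOn.intervalIntegrable (by
      filter_upwards [h.deriv_p, h.deriv_x, ae_comp_add_right h.deriv_p c, ae_comp_add_right h.deriv_x c]
        with s h1 h2 h3 h4 hs
      have hs0 := hs.1
      have hsc : 0 ≤ s + c := by linarith
      have dp := ((h3 hsc).comp_add_const s c).sub (h1 hs0)
      have dx := ((h4 hsc).comp_add_const s c).sub (h2 hs0)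
      refine ⟨_, ?_, ((dp.mul dp).add (dx.mul dx)).const_mul (1 / 2)⟩
      have hm := boxProj_sub_mul_sub_le (h.mem _ hsc) (h.mem _ hs0)
        (-a * p (s + c) - b - x (s + c) - w (s + c)) (-a * p s - b - x s - w s)
      simp only [Pi.sub_apply]
      nlinarith [mul_nonneg h.a_nonneg (sq_nonneg (p (s + c) - p s))])
  rw [intervalIntegral.integral_neg] at key
  simp only [zero_add] at key
  nlinarith [mul_self_nonneg (p (t + c) - p t), mul_self_nonneg (x (t + c) - x t)]

/-- Passivity of the controller with respect to the velocities of input and output. -/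
theorem exists_integral_deriv_le (h : IsProjectedController lo hi a b d p x w)
    (hv : ContinuousOn v (Ici 0)) (hw : ∀ᵐ t : ℝ, 0 ≤ t → HasDerivAt w (v t) t) :
    ∃ K, ∀ t, 0 ≤ t → ∫ s in (0)..t, v s * deriv p s ≤ K := by
  obtain ⟨C₁, hC₁⟩ := h.lipschitz_p 1
  obtain ⟨C₂, hC₂⟩ := h.lipschitz_x
  -- The incremental inequality is divided by `c ^ 2` and `c` tends to zero. Its right-hand side
  -- involves only the increments of `p` and `x` on `[0, c]` with `c ≤ 1`, so the bound does not
  -- depend on `t`; the constants `C` and `V` below do, but serve only for dominated convergence.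
  refine ⟨(C₁ ^ 2 + C₂ ^ 2) / 2, fun t ht => ?_⟩
  obtain ⟨C, hC⟩ := h.lipschitz_p (t + 1)
  obtain ⟨V, hV⟩ := isCompact_Icc.exists_bound_of_continuousOn
    (hv.mono (Icc_subset_Ici_self : Icc 0 (t + 1) ⊆ Ici 0))
  have hwL : ∀ s r, 0 ≤ s → s ≤ r → r ≤ t + 1 → |w r - w s| ≤ V * (r - s) := by
    intro s r hs hsr hr
    refine ((h.ac_w r (hs.trans hsr)).mono_Icc hs hsr le_rfl).abs_sub_le hsr ?_
    filter_upwards [hw] with q hq hm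
    exact ⟨_, hV q ⟨hs.trans hm.1, hm.2.trans hr⟩, hq (hs.trans hm.1)⟩
  have hcp := continuousOn_Ici_of_absolutelyContinuousOnInterval h.ac_p
  have hcw := continuousOn_Ici_of_absolutelyContinuousOnInterval h.ac_w
  have hstep : ∀ m : ℕ, 0 < (1 / ((m : ℝ) + 1)) ∧ 1 / ((m : ℝ) + 1) ≤ 1 := fun m =>
    ⟨by positivity, by rw [div_le_one (by positivity)]; linarith [(Nat.cast_nonneg m : (0:ℝ) ≤ m)]⟩
  have hsh : ∀ {f : ℝ → ℝ}, ContinuousOn f (Ici 0) → ∀ c, 0 ≤ c →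
      ContinuousOn (fun s => f (s + c) - f s) (Ici 0) := fun {f} hf c hc =>
    (hf.comp (by fun_prop) (fun s hs => by simp only [mem_Ici] at hs ⊢; linarith)).sub hf
  have hlim : Filter.Tendsto (fun m : ℕ => ∫ s in (0)..t,
      ((w (s + 1 / ((m : ℝ) + 1)) - w s) / (1 / ((m : ℝ) + 1))) *
        ((p (s + 1 / ((m : ℝ) + 1)) - p s) / (1 / ((m : ℝ) + 1)))) Filter.atTop
      (nhds (∫ s in (0)..t, v s * deriv p s)) := by
    refine intervalIntegral.tendsto_integral_filter_of_dominated_convergence (fun _ => V * C)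
      (Filter.Eventually.of_forall fun m => ?_) (Filter.Eventually.of_forall fun m => ?_)
      (by simp) ?_
    · refine ContinuousOn.aestronglyMeasurable ?_ measurableSet_uIoc
      rw [uIoc_of_le ht]
      exact (((hsh hcw _ (hstep m).1.le).div_const _).mul
        ((hsh hcp _ (hstep m).1.le).div_const _)).mono fun s hs => hs.1.le
    · refine Filter.Eventually.of_forall fun s hs => ?_
      rw [uIoc_of_le ht] at hs
      obtain ⟨h0, h1⟩ := hstep m
      generalize 1 / ((m : ℝ) + 1) = c at h0 h1 ⊢
      have e1 := hwL s (s + c) hs.1.le (by linarith) (by linarith [hs.2])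
      have e2 := hC s (s + c) hs.1.le (by linarith) (by linarith [hs.2])
      rw [add_sub_cancel_left] at e1 e2
      rw [norm_mul, norm_div, norm_div, Real.norm_of_nonneg h0.le]
      have e1' : ‖w (s + c) - w s‖ / c ≤ V := by rw [div_le_iff₀ h0]; exact e1
      have e2' : ‖p (s + c) - p s‖ / c ≤ C := by rw [div_le_iff₀ h0]; exact e2
      exact mul_le_mul e1' e2' (by positivity) ((by positivity : (0:ℝ) ≤ _).trans e1')
    · filter_upwards [hw, h.deriv_p] with s h1 h2 hs
      rw [uIoc_of_le ht] at hs
      have hz : Filter.Tendsto (fun m : ℕ => 1 / ((m : ℝ) + 1)) Filter.atTop (nhdsWithin 0 {0}ᶜ) :=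
        tendsto_nhdsWithin_iff.2 ⟨tendsto_one_div_add_atTop_nhds_zero_nat,
          Filter.Eventually.of_forall fun m => (hstep m).1.ne'⟩
      have l : ∀ {f : ℝ → ℝ} {f' : ℝ}, HasDerivAt f f' s → Filter.Tendsto (fun m : ℕ =>
          (f (s + 1 / ((m : ℝ) + 1)) - f s) / (1 / ((m : ℝ) + 1))) Filter.atTop (nhds f') := by
        intro f f' hf
        have := (hasDerivAt_iff_tendsto_slope_zero.1 hf).comp hz
        refine this.congr fun m => ?_
        simp only [Function.comp, smul_eq_mul]
        rw [inv_mul_eq_div]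
      exact (l (h1 hs.1.le)).mul (l (h2 hs.1.le).differentiableAt.hasDerivAt)
  refine le_of_tendsto hlim (Filter.Eventually.of_forall fun m => ?_)
  obtain ⟨h0, h1⟩ := hstep m
  generalize 1 / ((m : ℝ) + 1) = c at h0 h1 ⊢
  have hI := h.integral_increment_le h0.le ht
  have e1 := sq_le_sq' (by linarith [(abs_le.1 (hC₁ 0 c le_rfl h0.le h1)).1])
    (abs_le.1 (hC₁ 0 c le_rfl h0.le h1)).2
  have e2 := sq_le_sq' (by linarith [(abs_le.1 (hC₂ 0 c le_rfl h0.le)).1])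
    (abs_le.1 (hC₂ 0 c le_rfl h0.le)).2
  have : ∀ s, ((w (s + c) - w s) / c) * ((p (s + c) - p s) / c) =
      (c ^ 2)⁻¹ * ((w (s + c) - w s) * (p (s + c) - p s)) := fun s => by
    field_simp
  simp only [this, intervalIntegral.integral_const_mul]
  rw [inv_mul_le_iff₀ (by positivity)]
  rw [sub_zero] at e1 e2
  nlinarith

/-- The integrator state of the controller is bounded above if the target is admissible and the
input is bounded below. -/
theorem exists_le (h : IsProjectedController lo hi a b d p x w) (hd : lo ≤ d) {W : ℝ}
    (hW : ∀ t, 0 ≤ t → W ≤ w t) : ∃ K, ∀ t, 0 ≤ t → x t ≤ K := by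
  -- The quadratic term compensates for the lag of `p` behind `x`: once `x` is so large that the
  -- unprojected velocity of `p` is at most `-1`, the derivative of the sum is at most `(p - d) - (p
  -- - lo) = lo - d ≤ 0`. The threshold adds `(hi - lo) ^ 2 / 2`, so that a large sum forces a large
  -- `x`.
  have hac : ∀ t, 0 ≤ t →
      AbsolutelyContinuousOnInterval (fun s => x s + 1 / 2 * ((p s - lo) * (p s - lo))) 0 t :=
    fun t ht => (h.ac_x t ht).fun_add
      ((((h.ac_p t ht).fun_sub (AbsolutelyContinuousOnInterval.const lo 0 t)).fun_mul
        ((h.ac_p t ht).fun_sub (AbsolutelyContinuousOnInterval.const lo 0 t))).const_mul (1 / 2))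
  refine ⟨max (x 0 + 1 / 2 * ((p 0 - lo) * (p 0 - lo)))
    ((hi - lo) ^ 2 / 2 + (1 - a * lo - b - W)), fun t ht => ?_⟩
  have key := (hac t ht).le_max_of_deriv_nonpos ht
    (K := (hi - lo) ^ 2 / 2 + (1 - a * lo - b - W)) (by
      filter_upwards [h.deriv_p, h.deriv_x] with s h1 h2 hs hgt
      have dp := (h1 hs.1).sub_const lo
      refine ⟨_, ?_, (h2 hs.1).add ((dp.mul dp).const_mul (1 / 2))⟩
      obtain ⟨m1, m2⟩ := h.mem s hs.1
      have hap := mul_le_mul_of_nonneg_left m1 h.a_nonneg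
      have hsq : (p s - lo) * (p s - lo) ≤ (hi - lo) ^ 2 := by
        rw [← sq]; exact pow_le_pow_left₀ (sub_nonneg.2 m1) (by linarith) 2
      have hu : -a * p s - b - x s - w s ≤ -1 := by linarith [hW s hs.1]
      have hm := boxProj_mul_sub_le (x := p s) (y := lo) ⟨le_rfl, m1.trans m2⟩
        (-a * p s - b - x s - w s)
      have hu' := mul_le_mul_of_nonneg_right hu (sub_nonneg.2 m1)
      linarith)
  exact le_trans (by linarith [mul_self_nonneg (p t - lo)]) key

/-- Reflection symmetry, which turns the upper bound on the integrator state into a lower one. -/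
theorem neg (h : IsProjectedController lo hi a b d p x w) :
    IsProjectedController (-hi) (-lo) a (-b) (-d) (fun t => -p t) (fun t => -x t)
      (fun t => -w t) where
  a_nonneg := h.a_nonneg
  mem t ht := ⟨neg_le_neg (h.mem t ht).2, neg_le_neg (h.mem t ht).1⟩
  ac_p t ht := (h.ac_p t ht).fun_neg
  ac_x t ht := (h.ac_x t ht).fun_neg
  ac_w t ht := (h.ac_w t ht).fun_neg
  deriv_p := by
    filter_upwards [h.deriv_p] with t h1 ht
    convert! (h1 ht).neg using 1
    rw [← neg_boxProj]
    congr 1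
    ring
  deriv_x := by
    filter_upwards [h.deriv_x] with t h1 ht
    convert! (h1 ht).neg using 1
    ring

theorem exists_abs_le (h : IsProjectedController lo hi a b d p x w) (hd : d ∈ Icc lo hi) {W : ℝ}
    (hW : ∀ t, 0 ≤ t → |w t| ≤ W) : ∃ K, ∀ t, 0 ≤ t → |x t| ≤ K := by
  obtain ⟨K, hK⟩ := h.exists_le hd.1 fun t ht => (abs_le.1 (hW t ht)).1
  obtain ⟨L, hL⟩ := h.neg.exists_le (neg_le_neg hd.2)
    fun t ht => neg_le_neg (abs_le.1 (hW t ht)).2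
  exact ⟨max K L, fun t ht => abs_le.2
    ⟨by linarith [hL t ht, le_max_right K L], (hK t ht).trans (le_max_left K L)⟩⟩

end IsProjectedController

/-! ### The weighted Laplacian of the network. -/

namespace PowerNetwork

variable {n : ℕ} (net : PowerNetwork n)

/-- Tie-line sensitivities, extended by zero to all pairs of areas. -/
noncomputable def weight (i j : Fin (n + 1)) : ℝ :=
  open Classical in if net.graph.Adj i j then net.B i j else 0

theorem weight_symm (i j : Fin (n + 1)) : net.weight i j = net.weight j i := by
  unfold weight
  by_cases h : net.graph.Adj i j
  · rw [if_pos h, if_pos h.symm, net.B_symm i j h]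
  · rw [if_neg h, if_neg fun h' => h h'.symm]

theorem weight_nonneg (i j : Fin (n + 1)) : 0 ≤ net.weight i j := by
  unfold weight
  split_ifs with h
  exacts [(net.B_pos i j h).le, le_rfl]

theorem tiePower_eq (s : GridState n) (i : Fin (n + 1)) :
    net.tiePower s i = ∑ j, net.weight i j * (angle s i - angle s j) := by
  classical
  simp only [tiePower, weight, SimpleGraph.neighborFinset_eq_filter, Finset.sum_filter, ite_mul,
    zero_mul]

/-- Green's identity for the weighted Laplacian of the network. -/
theorem sum_mul_laplacian (x y : Fin (n + 1) → ℝ) :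
    2 * ∑ i, x i * ∑ j, net.weight i j * (y i - y j) =
      ∑ i, ∑ j, net.weight i j * ((x i - x j) * (y i - y j)) := by
  have h1 : ∑ i, ∑ j, net.weight i j * (x j * (y i - y j)) =
      -∑ i, ∑ j, net.weight i j * (x i * (y i - y j)) := by
    rw [Finset.sum_comm, ← Finset.sum_neg_distrib]
    refine Finset.sum_congr rfl fun i _ => ?_
    rw [← Finset.sum_neg_distrib]
    refine Finset.sum_congr rfl fun j _ => ?_
    rw [net.weight_symm j i]; ring
  have h2 : ∑ i, x i * ∑ j, net.weight i j * (y i - y j) =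
      ∑ i, ∑ j, net.weight i j * (x i * (y i - y j)) := by
    refine Finset.sum_congr rfl fun i _ => ?_
    rw [Finset.mul_sum]
    exact Finset.sum_congr rfl fun j _ => by ring
  simp only [sub_mul (x _) (x _), mul_sub (net.weight _ _) (x _ * _), Finset.sum_sub_distrib]
  rw [h1, h2]; ring

theorem sum_tiePower (s : GridState n) : ∑ i, net.tiePower s i = 0 := by
  have := net.sum_mul_laplacian (fun _ => 1) (angle s)
  simp only [sub_self, zero_mul, mul_zero, Finset.sum_const_zero, one_mul] at this
  simp only [tiePower_eq]
  linarith

/-- The weighted Laplacian of the network as a linear map. -/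
noncomputable def laplacian : (Fin (n + 1) → ℝ) →ₗ[ℝ] (Fin (n + 1) → ℝ) where
  toFun y i := ∑ j, net.weight i j * (y i - y j)
  map_add' y z := by
    ext i
    simp only [Pi.add_apply, ← Finset.sum_add_distrib]
    exact Finset.sum_congr rfl fun j _ => by ring
  map_smul' c y := by
    ext i
    simp only [Pi.smul_apply, smul_eq_mul, Finset.mul_sum, RingHom.id_apply]
    exact Finset.sum_congr rfl fun j _ => by ring

/-- The Dirichlet energy of `y` vanishes, so `y` agrees at the ends of every tie-line, and
connectedness propagates this along walks. -/
theorem eq_of_laplacian_eq_zero {y : Fin (n + 1) → ℝ} (hy : net.laplacian y = 0)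
    (i j : Fin (n + 1)) : y i = y j := by
  have h0 := net.sum_mul_laplacian y y
  have h1 : ∀ i, ∑ j, net.weight i j * (y i - y j) = 0 := fun i => congrFun hy i
  simp only [h1, mul_zero, Finset.sum_const_zero] at h0
  have hnn : ∀ i j, 0 ≤ net.weight i j * ((y i - y j) * (y i - y j)) := fun i j =>
    mul_nonneg (net.weight_nonneg i j) (mul_self_nonneg _)
  have hz : ∀ i j, net.weight i j * ((y i - y j) * (y i - y j)) = 0 := fun i j =>
    (Finset.sum_eq_zero_iff_of_nonneg fun j _ => hnn i j).1
      ((Finset.sum_eq_zero_iff_of_nonneg fun i _ => Finset.sum_nonneg fun j _ => hnn i j).1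
        h0.symm i (Finset.mem_univ _)) j (Finset.mem_univ _)
  have hadj : ∀ i j, net.graph.Adj i j → y i = y j := fun i j h => by
    have := hz i j
    rw [weight, if_pos h, mul_eq_zero, or_iff_right (net.B_pos i j h).ne', mul_self_eq_zero] at this
    linarith
  obtain ⟨p⟩ := net.graph_connected.preconnected i j
  induction p with
  | nil => rfl
  | cons h _ ih => exact (hadj _ _ h).trans ih

/-- Reduced angles are controlled by the tie-line powers. -/
theorem exists_abs_angle_le (C : ℝ) :
    ∃ K, ∀ s : GridState n, (∀ i, |net.tiePower s i| ≤ C) → ∀ i, |angle s i| ≤ K := by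
  -- The kernel of the Laplacian consists of constants, and recording the reference angle removes
  -- them. An injective linear map in finite dimension is bounded below.
  have hker : LinearMap.ker ((net.laplacian).prod
      (LinearMap.proj (R := ℝ) (φ := fun _ => ℝ) (Fin.last n))) = ⊥ := by
    rw [LinearMap.ker_eq_bot']
    intro y hy
    have h1 : net.laplacian y = 0 := congrArg Prod.fst hy
    have h2 : y (Fin.last n) = 0 := congrArg Prod.snd hy
    ext i
    rw [net.eq_of_laplacian_eq_zero h1 i (Fin.last n), h2, Pi.zero_apply]
  obtain ⟨K, -, hK⟩ := LinearMap.exists_antilipschitzWith _ hker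
  refine ⟨K * max C 0, fun s hs i => ?_⟩
  have h := hK.le_mul_dist (angle s) 0
  rw [map_zero, dist_zero_right, dist_zero_right] at h
  refine (norm_le_pi_norm (angle s) i).trans (h.trans ?_)
  refine mul_le_mul_of_nonneg_left ?_ K.2
  have hlast : angle s (Fin.last n) = 0 := by simp [angle]
  refine max_le ?_ ?_
  · refine (pi_norm_le_iff_of_nonneg (le_max_right _ _)).2 fun j => ?_
    refine le_trans ?_ ((hs j).trans (le_max_left _ _))
    rw [tiePower_eq]; exact le_rfl
  · simp [hlast]

/-! ### The safety corrector and the barrier inequalities. -/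

/-- Power withheld by the safety corrector. -/
noncomputable def curtailment (s : GridState n) (i : Fin (n + 1)) : ℝ := s.Pr i - net.Pg s i

variable {net} {s : GridState n} {i : Fin (n + 1)}

/-- The reference already obeys the capacity limits, and a feasible point gives `lTilde ≤ Phi`; both
limits therefore drop out of the clamp. -/
theorem Pg_eq_clamp (hs : s ∈ net.stateSet) (hf : (net.correctorFeasibleSet s i).Nonempty) :
    net.Pg s i = min (max (s.Pr i) (net.lTilde s i)) (net.uTilde s i) := by
  obtain ⟨q, h1, h2, h3, h4⟩ := hf
  obtain ⟨h5, h6⟩ := hs i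
  rw [Pg, ← max_assoc, max_eq_left h5, ← min_assoc, min_eq_left (max_le h6 (h3.trans h2))]

theorem lTilde_le_Pg (hs : s ∈ net.stateSet) (hf : (net.correctorFeasibleSet s i).Nonempty) :
    net.lTilde s i ≤ net.Pg s i := by
  rw [Pg_eq_clamp hs hf]
  obtain ⟨q, -, -, h3, h4⟩ := hf
  exact le_min (le_max_right _ _) (h3.trans h4)

theorem Pg_le_uTilde (hs : s ∈ net.stateSet) (hf : (net.correctorFeasibleSet s i).Nonempty) :
    net.Pg s i ≤ net.uTilde s i := by
  rw [Pg_eq_clamp hs hf]; exact min_le_right _ _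

theorem M_mul_field_w (s : GridState n) (i : Fin (n + 1)) :
    net.M i * (net.field s).w i = -net.D i * s.w i + net.Pg s i - net.d i - net.tiePower s i :=
  mul_inv_cancel_left₀ (net.M_pos i).ne' _

/-- `uTilde` is chosen to cancel damping, load and tie-line power, leaving a linear relaxation
towards the limit. -/
theorem field_w_eq_of_Pg_eq_uTilde (h : net.Pg s i = net.uTilde s i) :
    (net.field s).w i = net.β i * (net.whi i - s.w i) := by
  refine mul_left_cancel₀ (net.M_pos i).ne' ?_
  rw [M_mul_field_w, h, uTilde]; ring

theorem field_w_eq_of_Pg_eq_lTilde (h : net.Pg s i = net.lTilde s i) :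
    (net.field s).w i = net.β i * (net.wlo i - s.w i) := by
  refine mul_left_cancel₀ (net.M_pos i).ne' ?_
  rw [M_mul_field_w, h, lTilde]; ring

theorem field_w_le (hs : s ∈ net.stateSet) (hf : (net.correctorFeasibleSet s i).Nonempty) :
    (net.field s).w i ≤ net.β i * (net.whi i - s.w i) := by
  refine le_of_mul_le_mul_left ?_ (net.M_pos i)
  have h := Pg_le_uTilde hs hf
  rw [uTilde] at h
  rw [M_mul_field_w]; linarith

theorem le_field_w (hs : s ∈ net.stateSet) (hf : (net.correctorFeasibleSet s i).Nonempty) :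
    net.β i * (net.wlo i - s.w i) ≤ (net.field s).w i := by
  refine le_of_mul_le_mul_left ?_ (net.M_pos i)
  have h := lTilde_le_Pg hs hf
  rw [lTilde] at h
  rw [M_mul_field_w]; linarith

theorem Pg_eq_uTilde_of_curtailment_pos (hs : s ∈ net.stateSet)
    (hf : (net.correctorFeasibleSet s i).Nonempty) (h : 0 < net.curtailment s i) :
    net.Pg s i = net.uTilde s i := by
  rw [curtailment, Pg_eq_clamp hs hf] at h
  rw [Pg_eq_clamp hs hf]
  rcases min_choice (max (s.Pr i) (net.lTilde s i)) (net.uTilde s i) with h' | h'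
  · rw [h'] at h
    linarith [le_max_left (s.Pr i) (net.lTilde s i)]
  · exact h'

theorem Pg_eq_lTilde_of_curtailment_neg (hs : s ∈ net.stateSet)
    (hf : (net.correctorFeasibleSet s i).Nonempty) (h : net.curtailment s i < 0) :
    net.Pg s i = net.lTilde s i := by
  have hle := lTilde_le_Pg hs hf
  rw [curtailment, Pg_eq_clamp hs hf] at h
  rw [Pg_eq_clamp hs hf] at hle ⊢
  rcases max_choice (s.Pr i) (net.lTilde s i) with h' | h'
  · rw [h'] at h
    linarith [min_le_left (s.Pr i) (net.uTilde s i)]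
  · exact le_antisymm ((min_le_left _ _).trans h'.le) hle

theorem abs_curtailment_le (hs : s ∈ net.stateSet)
    (hf : (net.correctorFeasibleSet s i).Nonempty) :
    |net.curtailment s i| ≤ net.Phi i - net.Plo i := by
  obtain ⟨h5, h6⟩ := hs i
  have h7 : net.Pg s i ≤ net.Phi i := (min_le_right _ _).trans (min_le_left _ _)
  have h8 : net.Plo i ≤ net.Pg s i := by
    obtain ⟨q, h1, h2, h3, h4⟩ := hf
    exact le_min ((le_max_left _ _).trans (le_max_right _ _)) (le_min (h1.trans h2) (h1.trans h4))
  rw [curtailment, abs_le]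
  constructor <;> linarith

/-! ### Forward invariance and monotone approach -/

variable {T : EReal} {z : ℝ → GridState n}

theorem mem_timeDomain_of_le {s t : ℝ} (ht : t ∈ timeDomain T) (hs : 0 ≤ s) (hst : s ≤ t) :
    s ∈ timeDomain T :=
  ⟨hs, (EReal.coe_le_coe_iff.2 hst).trans_lt ht.2⟩

theorem w_le_max (hz : net.IsCaratheodorySolution T z) (hf : net.CorrectorFeasibleAlong T z)
    (i : Fin (n + 1)) {s t : ℝ} (hs : 0 ≤ s) (hst : s ≤ t) (ht : t ∈ timeDomain T) :
    (z t).w i ≤ max ((z s).w i) (net.whi i) := by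
  refine ((hz.ac_w i t ht).mono_Icc hs hst le_rfl).le_max_of_deriv_nonpos hst ?_
  filter_upwards [hz.deriv_ae] with r hr hm hlt
  have hr' := mem_timeDomain_of_le ht (hs.trans hm.1) hm.2
  refine ⟨_, ?_, (hr hr').2.1 i⟩
  exact (field_w_le (hz.mem r hr') (hf r hr' i)).trans
    (mul_nonpos_of_nonneg_of_nonpos (net.β_pos i).le (by linarith))

theorem min_le_w (hz : net.IsCaratheodorySolution T z) (hf : net.CorrectorFeasibleAlong T z)
    (i : Fin (n + 1)) {s t : ℝ} (hs : 0 ≤ s) (hst : s ≤ t) (ht : t ∈ timeDomain T) :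
    min ((z s).w i) (net.wlo i) ≤ (z t).w i := by
  have key := ((hz.ac_w i t ht).mono_Icc hs hst le_rfl).fun_neg.le_max_of_deriv_nonpos hst
    (K := -net.wlo i) (by
      filter_upwards [hz.deriv_ae] with r hr hm hlt
      have hr' := mem_timeDomain_of_le ht (hs.trans hm.1) hm.2
      refine ⟨_, ?_, ((hr hr').2.1 i).neg⟩
      exact neg_nonpos.2 ((mul_nonneg (net.β_pos i).le (by linarith)).trans
        (le_field_w (hz.mem r hr') (hf r hr' i))))
  rw [max_neg_neg] at key
  linarith

theorem mem_safeSet_of_mem (hz : net.IsCaratheodorySolution T z)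
    (hf : net.CorrectorFeasibleAlong T z) (i : Fin (n + 1)) {s t : ℝ} (hs : 0 ≤ s) (hst : s ≤ t)
    (ht : t ∈ timeDomain T) (h : (z s).w i ∈ net.safeSet i) : (z t).w i ∈ net.safeSet i :=
  ⟨(min_eq_right h.1).ge.trans (min_le_w hz hf i hs hst ht),
    (w_le_max hz hf i hs hst ht).trans (max_eq_right h.2).le⟩

theorem antitoneOn_infDist_safeSet (hz : net.IsCaratheodorySolution T z)
    (hf : net.CorrectorFeasibleAlong T z) (i : Fin (n + 1)) :
    AntitoneOn (fun t => Metric.infDist ((z t).w i) (net.safeSet i)) (timeDomain T) := by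
  intro s hs t ht hst
  have h1 := w_le_max hz hf i hs.1 hst ht
  have h2 := min_le_w hz hf i hs.1 hst ht
  have hlh : net.wlo i ≤ net.whi i := ((net.wlo_neg i).trans (net.whi_pos i)).le
  have hne : (net.safeSet i).Nonempty := ⟨_, left_mem_Icc.2 hlh⟩
  simp only
  rcases lt_or_ge (net.whi i) ((z t).w i) with hhi | hhi
  · have h3 : (z t).w i ≤ (z s).w i := by
      rcases le_max_iff.1 h1 with h | h
      · exact h
      · exact absurd hhi h.not_gt
    refine (Metric.infDist_le_dist_of_mem (right_mem_Icc.2 hlh)).trans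
      ((Metric.le_infDist hne).2 fun y hy => ?_)
    rw [Real.dist_eq, Real.dist_eq, abs_of_nonneg (by linarith), abs_of_nonneg (by linarith [hy.2])]
    linarith [hy.2]
  rcases lt_or_ge ((z t).w i) (net.wlo i) with hlo | hlo
  · have h3 : (z s).w i ≤ (z t).w i := by
      rcases min_le_iff.1 h2 with h | h
      · exact h
      · exact absurd hlo h.not_gt
    refine (Metric.infDist_le_dist_of_mem (left_mem_Icc.2 hlh)).trans
      ((Metric.le_infDist hne).2 fun y hy => ?_)
    rw [Real.dist_eq, Real.dist_eq, abs_of_nonpos (by linarith), abs_of_nonpos (by linarith [hy.1])]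
    linarith [hy.1]
  · rw [Metric.infDist_zero_of_mem (show (z t).w i ∈ net.safeSet i from ⟨hlo, hhi⟩)]
    exact Metric.infDist_nonneg

/-- A trajectory starting above the interval never drops below `wlo`, so being outside at a later
time means being above `whi`. -/
theorem antitoneOn_w (hz : net.IsCaratheodorySolution T z) (hf : net.CorrectorFeasibleAlong T z)
    (i : Fin (n + 1)) (h0 : net.whi i < (z 0).w i) :
    AntitoneOn (fun t => (z t).w i) {t ∈ timeDomain T | (z t).w i ∉ net.safeSet i} := by
  rintro s ⟨hs, -⟩ t ⟨ht, hout⟩ hst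
  have h1 := w_le_max hz hf i hs.1 hst ht
  have h2 := min_le_w hz hf i le_rfl ht.1 ht
  rw [min_eq_right (by linarith [net.wlo_neg i, net.whi_pos i])] at h2
  rcases le_max_iff.1 h1 with h | h
  · exact h
  · exact absurd ⟨h2, h⟩ hout

theorem monotoneOn_w (hz : net.IsCaratheodorySolution T z) (hf : net.CorrectorFeasibleAlong T z)
    (i : Fin (n + 1)) (h0 : (z 0).w i < net.wlo i) :
    MonotoneOn (fun t => (z t).w i) {t ∈ timeDomain T | (z t).w i ∉ net.safeSet i} := by
  rintro s ⟨hs, -⟩ t ⟨ht, hout⟩ hst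
  have h1 := w_le_max hz hf i le_rfl ht.1 ht
  have h2 := min_le_w hz hf i hs.1 hst ht
  rw [max_eq_right (by linarith [net.wlo_neg i, net.whi_pos i])] at h1
  rcases min_le_iff.1 h2 with h | h
  · exact h
  · exact absurd ⟨h, h1⟩ hout

end PowerNetwork

/-! ### Regularity of solutions on the infinite horizon and the energy estimate. -/

namespace PowerNetwork

variable {n : ℕ} {net : PowerNetwork n} {z : ℝ → GridState n}

theorem mem_timeDomain_top {t : ℝ} (ht : 0 ≤ t) : t ∈ timeDomain ⊤ := ⟨ht, EReal.coe_lt_top t⟩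

theorem angle_castSucc (s : GridState n) (k : Fin n) : angle s k.castSucc = s.α k := by
  simp [angle]

theorem angle_last (s : GridState n) : angle s (Fin.last n) = 0 := by
  simp [angle]

namespace IsCaratheodorySolution

theorem ac_angle (hz : net.IsCaratheodorySolution ⊤ z) (i : Fin (n + 1)) {t : ℝ} (ht : 0 ≤ t) :
    AbsolutelyContinuousOnInterval (fun s => angle (z s) i) 0 t := by
  cases i using Fin.lastCases with
  | last => simpa only [angle_last] using AbsolutelyContinuousOnInterval.const 0 0 t
  | cast k => simpa only [angle_castSucc] using hz.ac_α k t (mem_timeDomain_top ht)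

theorem ac_tiePower (hz : net.IsCaratheodorySolution ⊤ z) (i : Fin (n + 1)) {t : ℝ} (ht : 0 ≤ t) :
    AbsolutelyContinuousOnInterval (fun s => net.tiePower (z s) i) 0 t := by
  simp only [tiePower_eq]
  exact AbsolutelyContinuousOnInterval.fun_sum _ fun j _ =>
    ((hz.ac_angle i ht).fun_sub (hz.ac_angle j ht)).const_mul _

theorem ac_Pg (hz : net.IsCaratheodorySolution ⊤ z) (i : Fin (n + 1)) {t : ℝ} (ht : 0 ≤ t) :
    AbsolutelyContinuousOnInterval (fun s => net.Pg (z s) i) 0 t := by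
  have hc := fun c => AbsolutelyContinuousOnInterval.const c 0 t
  have hw := hz.ac_w i t (mem_timeDomain_top ht)
  have hφ := hz.ac_tiePower i ht
  simp only [Pg, lTilde, uTilde]
  exact ((hz.ac_Pr i t (mem_timeDomain_top ht)).fun_max ((hc _).fun_max
    ((((hw.const_mul _).fun_add (hc _)).fun_add (((hc _).fun_sub hw).const_mul _)).fun_add
      hφ))).fun_min ((hc _).fun_min
    ((((hw.const_mul _).fun_add (hc _)).fun_sub ((hw.fun_sub (hc _)).const_mul _)).fun_add hφ))

theorem ac_field_w (hz : net.IsCaratheodorySolution ⊤ z) (i : Fin (n + 1)) {t : ℝ} (ht : 0 ≤ t) :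
    AbsolutelyContinuousOnInterval (fun s => (net.field (z s)).w i) 0 t :=
  (((((hz.ac_w i t (mem_timeDomain_top ht)).const_mul _).fun_add (hz.ac_Pg i ht)).fun_sub
    (AbsolutelyContinuousOnInterval.const _ 0 t)).fun_sub (hz.ac_tiePower i ht)).const_mul _

theorem ac_curtailment (hz : net.IsCaratheodorySolution ⊤ z) (i : Fin (n + 1)) {t : ℝ}
    (ht : 0 ≤ t) : AbsolutelyContinuousOnInterval (fun s => net.curtailment (z s) i) 0 t :=
  (hz.ac_Pr i t (mem_timeDomain_top ht)).fun_sub (hz.ac_Pg i ht)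

theorem continuousOn_w (hz : net.IsCaratheodorySolution ⊤ z) (i : Fin (n + 1)) :
    ContinuousOn (fun s => (z s).w i) (Ici 0) :=
  continuousOn_Ici_of_absolutelyContinuousOnInterval fun t ht =>
    hz.ac_w i t (mem_timeDomain_top ht)

theorem continuousOn_field_w (hz : net.IsCaratheodorySolution ⊤ z) (i : Fin (n + 1)) :
    ContinuousOn (fun s => (net.field (z s)).w i) (Ici 0) :=
  continuousOn_Ici_of_absolutelyContinuousOnInterval fun _ ht => hz.ac_field_w i ht

theorem ae_hasDerivAt_angle (hz : net.IsCaratheodorySolution ⊤ z) :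
    ∀ᵐ t : ℝ, 0 ≤ t → ∀ i,
      HasDerivAt (fun s => angle (z s) i) ((z t).w i - (z t).w (Fin.last n)) t := by
  filter_upwards [hz.deriv_ae] with t ht h0 i
  cases i using Fin.lastCases with
  | last => simpa only [angle_last, sub_self] using hasDerivAt_const t (0 : ℝ)
  | cast k =>
    simp only [angle_castSucc]
    exact (ht (mem_timeDomain_top h0)).1 k

theorem ae_hasDerivAt_tiePower (hz : net.IsCaratheodorySolution ⊤ z) :
    ∀ᵐ t : ℝ, 0 ≤ t → ∀ i, HasDerivAt (fun s => net.tiePower (z s) i)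
      (∑ j, net.weight i j * ((z t).w i - (z t).w j)) t := by
  filter_upwards [hz.ae_hasDerivAt_angle] with t ht h0 i
  simp only [tiePower_eq]
  refine HasDerivAt.fun_sum fun j _ => ?_
  convert! ((ht h0 i).sub (ht h0 j)).const_mul (net.weight i j) using 1
  ring

theorem isProjectedController (hz : net.IsCaratheodorySolution ⊤ z) (i : Fin (n + 1)) :
    IsProjectedController (net.Plo i) (net.Phi i) (net.a i) (net.b i) (net.d i)
      (fun t => (z t).Pr i) (fun t => (z t).ξ i) (fun t => (z t).w i) where
  a_nonneg := (net.a_pos i).le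
  mem t ht := hz.mem t (mem_timeDomain_top ht) i
  ac_p t ht := hz.ac_Pr i t (mem_timeDomain_top ht)
  ac_x t ht := hz.ac_ξ i t (mem_timeDomain_top ht)
  ac_w t ht := hz.ac_w i t (mem_timeDomain_top ht)
  deriv_p := hz.deriv_ae.mono fun _ h ht => (h (mem_timeDomain_top ht)).2.2.1 i
  deriv_x := hz.deriv_ae.mono fun _ h ht => (h (mem_timeDomain_top ht)).2.2.2 i

/-- While the corrector is active, the acceleration relaxes at the barrier rate. -/
theorem curtailment_mul_deriv (hz : net.IsCaratheodorySolution ⊤ z)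
    (hf : net.CorrectorFeasibleAlong ⊤ z) (i : Fin (n + 1)) {t v' : ℝ} (ht : 0 < t)
    (hw : HasDerivAt (fun s => (z s).w i) ((net.field (z t)).w i) t)
    (hv : HasDerivAt (fun s => (net.field (z s)).w i) v' t) :
    net.curtailment (z t) i * v' =
      net.curtailment (z t) i * (-net.β i * (net.field (z t)).w i) := by
  have hc : ContinuousAt (fun s => net.curtailment (z s) i) t :=
    (continuousOn_Ici_of_absolutelyContinuousOnInterval fun _ h =>
      hz.ac_curtailment i h).continuousAt (Ici_mem_nhds ht)
  have hpos : ∀ᶠ s in nhds t, 0 ≤ s := Ici_mem_nhds ht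
  -- A nonzero curtailment keeps its sign near `t`, so the active barrier equality holds on a
  -- neighbourhood and may be differentiated. Where the curtailment is zero both sides vanish.
  have relax : ∀ c : ℝ, (∀ᶠ s in nhds t, (net.field (z s)).w i = net.β i * (c - (z s).w i)) →
      v' = -net.β i * (net.field (z t)).w i := fun c h => by
    have h1 := ((hw.const_sub c).const_mul (net.β i)).congr_of_eventuallyEq h
    rw [hv.unique h1]; ring
  rcases lt_trichotomy (net.curtailment (z t) i) 0 with h | h | h
  · rw [relax (net.wlo i)]
    filter_upwards [hc.eventually_lt_const h, hpos] with s hs h0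
    have hm := mem_timeDomain_top h0
    exact field_w_eq_of_Pg_eq_lTilde
      (Pg_eq_lTilde_of_curtailment_neg (hz.mem s hm) (hf s hm i) hs)
  · simp [h]
  · rw [relax (net.whi i)]
    filter_upwards [hc.eventually_const_lt h, hpos] with s hs h0
    have hm := mem_timeDomain_top h0
    exact field_w_eq_of_Pg_eq_uTilde
      (Pg_eq_uTilde_of_curtailment_pos (hz.mem s hm) (hf s hm i) hs)

/-- Grönwall's argument with integrating factor `exp (β t)`, applied to the barrier inequality. -/
theorem sub_whi_le (hz : net.IsCaratheodorySolution ⊤ z) (hf : net.CorrectorFeasibleAlong ⊤ z)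
    (i : Fin (n + 1)) {t : ℝ} (ht : 0 ≤ t) :
    (z t).w i - net.whi i ≤ ((z 0).w i - net.whi i) * Real.exp (-net.β i * t) := by
  have hexp : AbsolutelyContinuousOnInterval (fun s => Real.exp (net.β i * s)) 0 t :=
    ContDiffOn.absolutelyContinuousOnInterval (by fun_prop)
  have key := (((hz.ac_w i t (mem_timeDomain_top ht)).fun_sub
    (AbsolutelyContinuousOnInterval.const (net.whi i) 0 t)).fun_mul hexp).le_of_deriv_nonpos ht (by
      filter_upwards [hz.deriv_ae] with s hs hm
      have hd := mem_timeDomain_top hm.1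
      refine ⟨_, ?_, (((hs hd).2.1 i).sub_const (net.whi i)).mul
        ((hasDerivAt_id s).const_mul (net.β i)).exp⟩
      have h1 := field_w_le (hz.mem s hd) (hf s hd i)
      have h2 : ((net.field (z s)).w i + net.β i * ((z s).w i - net.whi i)) *
          Real.exp (net.β i * s) ≤ 0 :=
        mul_nonpos_of_nonpos_of_nonneg (by linarith) (Real.exp_pos _).le
      simp only [id]
      linarith)
  simp only [mul_zero, Real.exp_zero, mul_one] at key
  calc (z t).w i - net.whi i
      = ((z t).w i - net.whi i) * Real.exp (net.β i * t) * Real.exp (-net.β i * t) := by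
        rw [mul_assoc, ← Real.exp_add]; simp
    _ ≤ _ := mul_le_mul_of_nonneg_right key (Real.exp_pos _).le

theorem wlo_sub_le (hz : net.IsCaratheodorySolution ⊤ z) (hf : net.CorrectorFeasibleAlong ⊤ z)
    (i : Fin (n + 1)) {t : ℝ} (ht : 0 ≤ t) :
    net.wlo i - (z t).w i ≤ (net.wlo i - (z 0).w i) * Real.exp (-net.β i * t) := by
  have hexp : AbsolutelyContinuousOnInterval (fun s => Real.exp (net.β i * s)) 0 t :=
    ContDiffOn.absolutelyContinuousOnInterval (by fun_prop)
  have key := (((AbsolutelyContinuousOnInterval.const (net.wlo i) 0 t).fun_sub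
    (hz.ac_w i t (mem_timeDomain_top ht))).fun_mul hexp).le_of_deriv_nonpos ht (by
      filter_upwards [hz.deriv_ae] with s hs hm
      have hd := mem_timeDomain_top hm.1
      refine ⟨_, ?_, (((hs hd).2.1 i).const_sub (net.wlo i)).mul
        ((hasDerivAt_id s).const_mul (net.β i)).exp⟩
      have h1 := le_field_w (hz.mem s hd) (hf s hd i)
      have h2 : (-(net.field (z s)).w i + net.β i * (net.wlo i - (z s).w i)) *
          Real.exp (net.β i * s) ≤ 0 :=
        mul_nonpos_of_nonpos_of_nonneg (by linarith) (Real.exp_pos _).le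
      simp only [id]
      linarith)
  simp only [mul_zero, Real.exp_zero, mul_one] at key
  calc net.wlo i - (z t).w i
      = (net.wlo i - (z t).w i) * Real.exp (net.β i * t) * Real.exp (-net.β i * t) := by
        rw [mul_assoc, ← Real.exp_add]; simp
    _ ≤ _ := mul_le_mul_of_nonneg_right key (Real.exp_pos _).le

/-- The power injected by the corrector against the acceleration decays exponentially. -/
theorem exists_neg_mul_curtailment_le (hz : net.IsCaratheodorySolution ⊤ z)
    (hf : net.CorrectorFeasibleAlong ⊤ z) (i : Fin (n + 1)) :
    ∃ C, ∀ t, 0 ≤ t → -((net.field (z t)).w i * net.curtailment (z t) i) ≤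
      C * Real.exp (-net.β i * t) := by
  set A := |(z 0).w i - net.whi i| + |net.wlo i - (z 0).w i| with hA
  have hA0 : 0 ≤ A := by positivity
  refine ⟨net.β i * A * (net.Phi i - net.Plo i), fun t ht => ?_⟩
  have hd := mem_timeDomain_top ht
  have hs := hz.mem t hd
  have hb := abs_le.1 (abs_curtailment_le hs (hf t hd i))
  have hβ := net.β_pos i
  have he := Real.exp_pos (-net.β i * t)
  have hu : (z t).w i - net.whi i ≤ A * Real.exp (-net.β i * t) :=
    (hz.sub_whi_le hf i ht).trans (mul_le_mul_of_nonneg_right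
      ((le_abs_self _).trans (le_add_of_nonneg_right (abs_nonneg _))) he.le)
  have hl : net.wlo i - (z t).w i ≤ A * Real.exp (-net.β i * t) :=
    (hz.wlo_sub_le hf i ht).trans (mul_le_mul_of_nonneg_right
      ((le_abs_self _).trans (le_add_of_nonneg_left (abs_nonneg _))) he.le)
  have hAe : 0 ≤ A * Real.exp (-net.β i * t) := by positivity
  have fin : ∀ x y : ℝ, x ≤ A * Real.exp (-net.β i * t) → 0 ≤ y → y ≤ net.Phi i - net.Plo i →
      net.β i * x * y ≤ net.β i * A * (net.Phi i - net.Plo i) * Real.exp (-net.β i * t) := by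
    intro x y hx hy hy'
    calc net.β i * x * y ≤ net.β i * (A * Real.exp (-net.β i * t)) * y := by gcongr
      _ ≤ net.β i * (A * Real.exp (-net.β i * t)) * (net.Phi i - net.Plo i) := by gcongr
      _ = _ := by ring
  -- If the curtailment is nonzero, the acceleration is `β` times the signed distance to the active
  -- limit; opposing signs require a violation of that limit, which decays exponentially.
  rcases lt_trichotomy (net.curtailment (z t) i) 0 with h | h | h
  · rw [field_w_eq_of_Pg_eq_lTilde (Pg_eq_lTilde_of_curtailment_neg hs (hf t hd i) h)]
    have := fin _ _ hl (neg_nonneg.2 h.le) (by linarith [hb.1])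
    linarith
  · rw [h]
    have := fin 0 0 hAe le_rfl (by linarith [hb.1, hb.2])
    linarith
  · rw [field_w_eq_of_Pg_eq_uTilde (Pg_eq_uTilde_of_curtailment_pos hs (hf t hd i) h)]
    have := fin _ _ hu h.le hb.2
    linarith

/-- The accelerations of all areas are square integrable on `[0, ∞)`. -/
theorem exists_integral_sq_le (hz : net.IsCaratheodorySolution ⊤ z)
    (hf : net.CorrectorFeasibleAlong ⊤ z) (i : Fin (n + 1)) :
    ∃ K, ∀ t, 0 ≤ t → ∫ s in (0)..t, (net.field (z s)).w i ^ 2 ≤ K := by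
  choose C hC using hz.exists_neg_mul_curtailment_le hf
  choose K hK using fun j => (hz.isProjectedController j).exists_integral_deriv_le
    (hz.continuousOn_field_w j)
    (hz.deriv_ae.mono fun _ h ht => (h (mem_timeDomain_top ht)).2.1 j)
  -- The exponential term makes `E` nonnegative despite the indefinite product `v c`, and its
  -- derivative absorbs the term `-β v c` produced by `v' c`. The double sum counts each tie-line
  -- twice, hence `1 / 4` instead of `1 / 2`.
  let E : ℝ → ℝ := fun s =>
    ∑ j, (net.M j / 2 * ((net.field (z s)).w j * (net.field (z s)).w j) +
      (net.field (z s)).w j * net.curtailment (z s) j + C j * Real.exp (-net.β j * s)) +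
    1 / 4 * ∑ j, ∑ k, net.weight j k *
      (((z s).w j - (z s).w k) * ((z s).w j - (z s).w k))
  have hE0 : ∀ t, 0 ≤ t → 0 ≤ E t := fun t ht => by
    refine add_nonneg (Finset.sum_nonneg fun j _ => ?_) (mul_nonneg (by norm_num)
      (Finset.sum_nonneg fun j _ => Finset.sum_nonneg fun k _ =>
        mul_nonneg (net.weight_nonneg j k) (mul_self_nonneg _)))
    have h1 : 0 ≤ net.M j / 2 * ((net.field (z t)).w j * (net.field (z t)).w j) :=
      mul_nonneg (by linarith [net.M_pos j]) (mul_self_nonneg _)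
    linarith [hC j t ht]
  refine ⟨(E 0 + ∑ j, K j) / net.D i, fun t ht => ?_⟩
  have hv := fun j => hz.ac_field_w j ht
  have hw := fun j => hz.ac_w j t (mem_timeDomain_top ht)
  have hEac : AbsolutelyContinuousOnInterval E 0 t :=
    (AbsolutelyContinuousOnInterval.fun_sum _ fun j _ =>
      ((((hv j).fun_mul (hv j)).const_mul _).fun_add ((hv j).fun_mul (hz.ac_curtailment j ht))).fun_add
        (AbsolutelyContinuousOnInterval.const_mul _
          (ContDiffOn.absolutelyContinuousOnInterval (by fun_prop)))).fun_add
    (AbsolutelyContinuousOnInterval.const_mul _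
      (AbsolutelyContinuousOnInterval.fun_sum _ fun j _ =>
        AbsolutelyContinuousOnInterval.fun_sum _ fun k _ =>
          (((hw j).fun_sub (hw k)).fun_mul ((hw j).fun_sub (hw k))).const_mul _))
  have hint1 : ∀ j, IntervalIntegrable
      (fun s => (net.field (z s)).w j * deriv (fun r => (z r).Pr j) s) volume 0 t := fun j =>
    (hz.ac_Pr j t (mem_timeDomain_top ht)).intervalIntegrable_deriv.continuousOn_mul
      (hv j).continuousOn
  have hint2 : ∀ j, IntervalIntegrable (fun s => net.D j * (net.field (z s)).w j ^ 2) volume 0 t :=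
    fun j => (((hv j).continuousOn.pow 2).intervalIntegrable).const_mul _
  have key := hEac.sub_le_integral ht
    (g := fun s => ∑ j, ((net.field (z s)).w j * deriv (fun r => (z r).Pr j) s -
      net.D j * (net.field (z s)).w j ^ 2))
    (by
      have := IntervalIntegrable.sum Finset.univ fun j (_ : j ∈ Finset.univ) =>
        (hint1 j).sub (hint2 j)
      convert! this using 1
      ext s
      simp [Finset.sum_apply]) (by
      have hdiff : ∀ᵐ s : ℝ, ∀ j, s ∈ uIcc 0 t →
          DifferentiableAt ℝ (fun s => (net.field (z s)).w j) s :=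
        ae_all_iff.2 fun j => (hv j).ae_differentiableAt
      -- Time `0` is discarded because `curtailment_mul_deriv` needs a two-sided neighbourhood.
      filter_upwards [hz.deriv_ae, hz.ae_hasDerivAt_tiePower, hdiff, Measure.ae_ne volume 0]
        with s h1 h2 h3 hne hm
      rw [uIcc_of_le ht] at h3
      obtain ⟨-, dw, dP, -⟩ := h1 (mem_timeDomain_top hm.1)
      have dφ := h2 hm.1
      have dv := fun j => (h3 j hm).hasDerivAt
      -- The swing equation eliminates `Pg` from the curtailment, so no derivative of the clamp is
      -- needed. Multiplied by `v`, the result cancels the derivatives of the kinetic and potential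
      -- terms and leaves `v Pr' - D v²`.
      have de : ∀ j, HasDerivAt (fun s => net.curtailment (z s) j)
          (deriv (fun r => (z r).Pr j) s - (net.M j * deriv (fun s => (net.field (z s)).w j) s +
            net.D j * (net.field (z s)).w j +
              ∑ k, net.weight j k * ((z s).w j - (z s).w k))) s := fun j => by
        have e1 : (fun s => net.curtailment (z s) j) = fun s => (z s).Pr j -
            (net.M j * (net.field (z s)).w j + net.D j * (z s).w j + net.tiePower (z s) j +
              net.d j) := by
          ext s
          rw [M_mul_field_w, curtailment]; ring
        rw [e1]
        exact (dP j).differentiableAt.hasDerivAt.sub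
          (((((dv j).const_mul _).add ((dw j).const_mul _)).add (dφ j)).add_const _)
      refine ⟨_, ?_, (HasDerivAt.fun_sum fun j _ =>
        ((((dv j).mul (dv j)).const_mul (net.M j / 2)).add ((dv j).mul (de j))).add
          (((hasDerivAt_id s).const_mul (-net.β j)).exp.const_mul (C j))).add
        (HasDerivAt.const_mul (1 / 4) (HasDerivAt.fun_sum fun j _ => HasDerivAt.fun_sum fun k _ =>
          (((dw j).sub (dw k)).mul ((dw j).sub (dw k))).const_mul (net.weight j k)))⟩
      have green := net.sum_mul_laplacian (net.field (z s)).w (z s).w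
      have hquad : ∑ j, ∑ k, net.weight j k *
          (((net.field (z s)).w j - (net.field (z s)).w k) * ((z s).w j - (z s).w k) +
            ((z s).w j - (z s).w k) * ((net.field (z s)).w j - (net.field (z s)).w k)) =
          4 * ∑ j, (net.field (z s)).w j * ∑ k, net.weight j k * ((z s).w j - (z s).w k) := by
        rw [show (4 : ℝ) = 2 * 2 by norm_num, mul_assoc, green, Finset.mul_sum]
        refine Finset.sum_congr rfl fun j _ => ?_
        rw [Finset.mul_sum]
        exact Finset.sum_congr rfl fun k _ => by ring
      simp only [Pi.sub_apply, id]
      rw [hquad, ← mul_assoc, show (1 / 4 : ℝ) * 4 = 1 by norm_num, one_mul,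
        ← Finset.sum_add_distrib]
      refine Finset.sum_le_sum fun j _ => ?_
      have hrel := hz.curtailment_mul_deriv hf j (lt_of_le_of_ne hm.1 hne.symm) (dw j) (dv j)
      have hdec := mul_le_mul_of_nonneg_left (hC j s hm.1) (net.β_pos j).le
      generalize ∑ k, net.weight j k * ((z s).w j - (z s).w k) = L
      linarith)
  have hsum : ∫ s in (0)..t, ∑ j, ((net.field (z s)).w j * deriv (fun r => (z r).Pr j) s -
      net.D j * (net.field (z s)).w j ^ 2) =
      ∑ j, ((∫ s in (0)..t, (net.field (z s)).w j * deriv (fun r => (z r).Pr j) s) -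
        net.D j * ∫ s in (0)..t, (net.field (z s)).w j ^ 2) := by
    rw [intervalIntegral.integral_finsetSum fun j _ => (hint1 j).sub (hint2 j)]
    refine Finset.sum_congr rfl fun j _ => ?_
    rw [intervalIntegral.integral_sub (hint1 j) (hint2 j), intervalIntegral.integral_const_mul]
  rw [hsum, Finset.sum_sub_distrib] at key
  have hKs := Finset.sum_le_sum fun j (_ : j ∈ Finset.univ) => hK j t ht
  have hsingle : net.D i * ∫ s in (0)..t, (net.field (z s)).w i ^ 2 ≤
      ∑ j, net.D j * ∫ s in (0)..t, (net.field (z s)).w j ^ 2 :=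
    Finset.single_le_sum (f := fun j => net.D j * ∫ s in (0)..t, (net.field (z s)).w j ^ 2)
      (fun j _ => mul_nonneg (net.D_pos j).le
        (intervalIntegral.integral_nonneg ht fun s _ => sq_nonneg _)) (Finset.mem_univ i)
  rw [le_div_iff₀ (net.D_pos i)]
  linarith [hE0 t ht]

end IsCaratheodorySolution

end PowerNetwork

/-! ### Boundedness, synchronization in the mean and finite-time entry. -/

namespace PowerNetwork

variable {n : ℕ} {net : PowerNetwork n} {z : ℝ → GridState n}

namespace IsCaratheodorySolution

theorem exists_abs_w_le (hz : net.IsCaratheodorySolution ⊤ z)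
    (hf : net.CorrectorFeasibleAlong ⊤ z) (i : Fin (n + 1)) :
    ∃ K, ∀ t, 0 ≤ t → |(z t).w i| ≤ K := by
  refine ⟨max (-min ((z 0).w i) (net.wlo i)) (max ((z 0).w i) (net.whi i)), fun t ht => ?_⟩
  have h1 := w_le_max hz hf i le_rfl ht (mem_timeDomain_top ht)
  have h2 := min_le_w hz hf i le_rfl ht (mem_timeDomain_top ht)
  exact abs_le'.2 ⟨h1.trans (le_max_right _ _), (neg_le_neg h2).trans (le_max_left _ _)⟩

/-- A feasible point lies within capacity and between `lTilde` and `uTilde`, both equal to the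
tie-line power plus terms bounded along the solution; this bounds the tie-line power on both sides.
-/
theorem exists_abs_tiePower_le (hz : net.IsCaratheodorySolution ⊤ z)
    (hf : net.CorrectorFeasibleAlong ⊤ z) :
    ∃ K, ∀ t, 0 ≤ t → ∀ i, |net.tiePower (z t) i| ≤ K := by
  choose W hW using hz.exists_abs_w_le hf
  let R : Fin (n + 1) → ℝ := fun i => |net.Plo i| + |net.Phi i| + |net.d i| + net.D i * W i +
    net.β i * net.M i * (|net.wlo i| + |net.whi i| + W i)
  refine ⟨∑ i, |R i|, fun t ht i => ?_⟩
  refine le_trans ?_ ((le_abs_self (R i)).trans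
    (Finset.single_le_sum (f := fun i => |R i|) (fun j _ => abs_nonneg _) (Finset.mem_univ i)))
  obtain ⟨q, h1, h2, h3, h4⟩ := hf t (mem_timeDomain_top ht) i
  rw [lTilde] at h3
  rw [uTilde] at h4
  have hw := hW i t ht
  have hDw := abs_le.1 ((abs_mul (net.D i) ((z t).w i)).le.trans
    (mul_le_mul (abs_of_pos (net.D_pos i)).le hw (abs_nonneg _) (net.D_pos i).le))
  have hβM := mul_pos (net.β_pos i) (net.M_pos i)
  have hb : ∀ c : ℝ, |c| ≤ |net.wlo i| + |net.whi i| + W i →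
      |net.β i * net.M i * c| ≤ net.β i * net.M i * (|net.wlo i| + |net.whi i| + W i) := by
    intro c hc
    rw [abs_mul, abs_of_pos hβM]
    exact mul_le_mul_of_nonneg_left hc hβM.le
  have b1 := abs_le.1 (hb (net.wlo i - (z t).w i)
    ((abs_sub _ _).trans (by linarith [abs_nonneg (net.whi i)])))
  have b2 := abs_le.1 (hb ((z t).w i - net.whi i)
    ((abs_sub _ _).trans (by linarith [abs_nonneg (net.wlo i)])))
  have hd := abs_le.1 (le_refl |net.d i|)
  have hlo := abs_le.1 (le_refl |net.Plo i|)
  have hhi := abs_le.1 (le_refl |net.Phi i|)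
  rw [abs_le]
  constructor <;> simp only [R] <;> linarith [hDw.1, hDw.2, b1.1, b1.2, b2.1, b2.2]

theorem isMeanNull_field_w (hz : net.IsCaratheodorySolution ⊤ z)
    (hf : net.CorrectorFeasibleAlong ⊤ z) (i : Fin (n + 1)) :
    IsMeanNull fun t => (net.field (z t)).w i := by
  obtain ⟨K, hK⟩ := hz.exists_integral_sq_le hf i
  refine .of_sq (hz.continuousOn_field_w i)
    (.of_integral_le ((hz.continuousOn_field_w i).pow 2) (K := K) fun t ht => ?_)
  simpa only [abs_pow, sq_abs] using hK t ht

/-- The frequencies synchronize in the mean. -/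
theorem isMeanNull_w_sub (hz : net.IsCaratheodorySolution ⊤ z)
    (hf : net.CorrectorFeasibleAlong ⊤ z) (i j : Fin (n + 1)) :
    IsMeanNull fun t => (z t).w i - (z t).w j := by
  obtain ⟨P, hP⟩ := hz.exists_abs_tiePower_le hf
  obtain ⟨A, hA⟩ := net.exists_abs_angle_le P
  obtain ⟨W, hW⟩ := hz.exists_abs_w_le hf i
  obtain ⟨W', hW'⟩ := hz.exists_abs_w_le hf j
  have hang : ∀ t, 0 ≤ t → |angle (z t) i - angle (z t) j| ≤ 2 * A := fun t ht =>
    (abs_sub _ _).trans (by linarith [hA (z t) (hP t ht) i, hA (z t) (hP t ht) j])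
  have hdif : ∀ t, 0 ≤ t → |(z t).w i - (z t).w j| ≤ W + W' := fun t ht =>
    (abs_sub _ _).trans (add_le_add (hW t ht) (hW' t ht))
  have hcw : ContinuousOn (fun t => (z t).w i - (z t).w j) (Ici 0) :=
    (hz.continuousOn_w i).sub (hz.continuousOn_w j)
  have hcw2 : ContinuousOn (fun t => ((z t).w i - (z t).w j) ^ 2) (Ici 0) := hcw.pow 2
  have hnull : IsMeanNull fun t =>
      2 * A * |(net.field (z t)).w i + -1 * (net.field (z t)).w j| :=
    ((hz.isMeanNull_field_w hf i).add ((hz.isMeanNull_field_w hf j).const_mul (-1))).abs.const_mul _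
  refine .of_sq hcw ⟨hcw2, fun δ hδ => ?_⟩
  obtain ⟨K, hK⟩ := hnull.2 δ hδ
  refine ⟨2 * (2 * A * (W + W')) + K, fun t ht => ?_⟩
  have hww := (hz.ac_w i t (mem_timeDomain_top ht)).fun_sub (hz.ac_w j t (mem_timeDomain_top ht))
  -- The product of angle and frequency differences is bounded, and its derivative is the squared
  -- frequency difference plus the angle difference times a mean-null acceleration difference.
  have key := (((hz.ac_angle i ht).fun_sub (hz.ac_angle j ht)).fun_mul hww).fun_neg.sub_le_integral
    ht (g := fun s => 2 * A * |(net.field (z s)).w i + -1 * (net.field (z s)).w j| -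
      ((z s).w i - (z s).w j) ^ 2)
    ((hnull.1.sub hcw2).intervalIntegrable_of_Ici ht) (by
      filter_upwards [hz.deriv_ae, hz.ae_hasDerivAt_angle] with s h1 h2 hm
      have dw := (h1 (mem_timeDomain_top hm.1)).2.1
      refine ⟨_, ?_, (((h2 hm.1 i).sub (h2 hm.1 j)).mul ((dw i).sub (dw j))).neg⟩
      have hprod : -((angle (z s) i - angle (z s) j) *
          ((net.field (z s)).w i - (net.field (z s)).w j)) ≤
          2 * A * |(net.field (z s)).w i + -1 * (net.field (z s)).w j| := by
        refine (neg_le_abs _).trans ?_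
        rw [abs_mul, neg_one_mul, ← sub_eq_add_neg]
        exact mul_le_mul_of_nonneg_right (hang s hm.1) (abs_nonneg _)
      simp only [Pi.sub_apply]
      linarith)
  rw [intervalIntegral.integral_sub (hnull.1.intervalIntegrable_of_Ici ht)
    (hcw2.intervalIntegrable_of_Ici ht)] at key
  have hb : ∀ s, 0 ≤ s → |(angle (z s) i - angle (z s) j) * ((z s).w i - (z s).w j)| ≤
      2 * A * (W + W') := fun s hs => by
    rw [abs_mul]
    exact mul_le_mul (hang s hs) (hdif s hs) (abs_nonneg _) ((abs_nonneg _).trans (hang s hs))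
  have hbt := abs_le.1 (hb t ht)
  have hb0 := abs_le.1 (hb 0 le_rfl)
  have hle : ∫ s in (0)..t, 2 * A * |(net.field (z s)).w i + -1 * (net.field (z s)).w j| ≤
      ∫ s in (0)..t, abs (2 * A * |(net.field (z s)).w i + -1 * (net.field (z s)).w j|) :=
    intervalIntegral.integral_mono_on ht (hnull.1.intervalIntegrable_of_Ici ht)
      (hnull.1.abs.intervalIntegrable_of_Ici ht) fun s _ => le_abs_self _
  simp only [abs_pow, sq_abs]
  linarith [hK t ht, hbt.2, hb0.1]

/-- Damping losses and curtailment balance in the mean. -/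
theorem not_le_sum_damping_add_curtailment (hz : net.IsCaratheodorySolution ⊤ z)
    (hf : net.CorrectorFeasibleAlong ⊤ z) (hD : net.DispatchFeasible) {c σ : ℝ} {g : ℝ → ℝ}
    (hc : 0 < c) (hg : IsMeanNull g)
    (h : ∀ t, 0 ≤ t → c - g t ≤ σ * ∑ j, (net.D j * (z t).w j + net.curtailment (z t) j)) :
    False := by
  choose W hW using hz.exists_abs_w_le hf
  obtain ⟨P, hP₁, hP₂⟩ := hD
  choose X hX using fun j => (hz.isProjectedController j).exists_abs_le
    (by have := hP₁ j; rw [show net.d j = P j by linarith]; exact hP₂ j) (hW j)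
  -- `Q` is bounded, since dispatch feasibility bounds each `ξ j`, and its derivative is the
  -- right-hand side of `h`. The sign `σ` serves both frequency limits.
  let Q : ℝ → ℝ := fun s => σ * ∑ j, ((z s).ξ j - net.M j * (z s).w j)
  have hQ : ∀ t, 0 ≤ t → |Q t| ≤ |σ| * ∑ j, (X j + net.M j * W j) := fun t ht => by
    rw [abs_mul]
    refine mul_le_mul_of_nonneg_left ((Finset.abs_sum_le_sum_abs _ _).trans
      (Finset.sum_le_sum fun j _ => (abs_sub _ _).trans (add_le_add (hX j t ht) ?_))) (abs_nonneg σ)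
    rw [abs_mul, abs_of_pos (net.M_pos j)]
    exact mul_le_mul_of_nonneg_left (hW j t ht) (net.M_pos j).le
  refine hg.not_linear_le hc (K := 2 * (|σ| * ∑ j, (X j + net.M j * W j))) fun t ht => ?_
  have hac : AbsolutelyContinuousOnInterval Q 0 t :=
    AbsolutelyContinuousOnInterval.const_mul σ (AbsolutelyContinuousOnInterval.fun_sum _ fun j _ =>
      (hz.ac_ξ j t (mem_timeDomain_top ht)).fun_sub
        ((hz.ac_w j t (mem_timeDomain_top ht)).const_mul _))
  have hgi := hg.1.intervalIntegrable_of_Ici ht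
  have key := hac.fun_neg.sub_le_integral ht (g := fun s => g s - c) (hgi.sub (by simp)) (by
    filter_upwards [hz.deriv_ae] with s h1 hm
    obtain ⟨-, dw, -, dξ⟩ := h1 (mem_timeDomain_top hm.1)
    refine ⟨_, ?_, ((HasDerivAt.fun_sum fun j _ =>
      (dξ j).sub ((dw j).const_mul (net.M j))).const_mul σ).neg⟩
    have e : ∑ j, ((net.field (z s)).ξ j - net.M j * (net.field (z s)).w j) =
        ∑ j, (net.D j * (z s).w j + net.curtailment (z s) j) := by
      have : ∀ j, (net.field (z s)).ξ j - net.M j * (net.field (z s)).w j =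
          net.D j * (z s).w j + net.curtailment (z s) j + net.tiePower (z s) j := fun j => by
        rw [M_mul_field_w, curtailment]
        simp only [field]
        ring
      simp only [this]
      rw [Finset.sum_add_distrib (f := fun j => net.D j * (z s).w j + net.curtailment (z s) j),
        sum_tiePower, add_zero]
    rw [e]
    linarith [h s hm.1])
  rw [intervalIntegral.integral_sub hgi (by simp), intervalIntegral.integral_const, smul_eq_mul,
    sub_zero] at key
  linarith [(abs_le.1 (hQ t ht)).2, (abs_le.1 (hQ 0 le_rfl)).1]

theorem exists_w_le_whi (hz : net.IsCaratheodorySolution ⊤ z)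
    (hf : net.CorrectorFeasibleAlong ⊤ z) (hD : net.DispatchFeasible) (i : Fin (n + 1)) :
    ∃ t, 0 ≤ t ∧ (z t).w i ≤ net.whi i := by
  by_contra! hgt
  -- The gap between the limit exceeded by area `i` and the opposite limit of area `j`.
  let κ : Fin (n + 1) → ℝ := fun j => net.whi i - net.wlo j
  have hκ : ∀ j, 0 < κ j := fun j => sub_pos.2 ((net.wlo_neg j).trans (net.whi_pos i))
  have hge : ∀ t, 0 ≤ t → net.whi i ≤ (z t).w i := fun t ht => (hgt t ht).le
  have hP : ∀ j, 0 ≤ net.Phi j - net.Plo j := fun j =>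
    (abs_nonneg _).trans (abs_curtailment_le (hz.mem 0 (mem_timeDomain_top le_rfl))
      (hf 0 (mem_timeDomain_top le_rfl) j))
  refine hz.not_le_sum_damping_add_curtailment hf hD (c := ∑ j, net.D j * net.whi i) (σ := 1)
    (g := fun t => ∑ j, (net.D j * |(z t).w j - (z t).w i| + (net.Phi j - net.Plo j) / κ j *
      ((net.β j)⁻¹ * |(net.field (z t)).w j| + |(z t).w j - (z t).w i|)))
    (Finset.sum_pos (fun j _ => mul_pos (net.D_pos j) (net.whi_pos i)) Finset.univ_nonempty)
    (IsMeanNull.sum _ fun j _ => ((hz.isMeanNull_w_sub hf j i).abs.const_mul _).add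
      ((((hz.isMeanNull_field_w hf j).abs.const_mul _).add
        (hz.isMeanNull_w_sub hf j i).abs).const_mul _)) fun t ht => ?_
  rw [one_mul, ← Finset.sum_sub_distrib]
  refine Finset.sum_le_sum fun j _ => ?_
  have hd := mem_timeDomain_top ht
  have hβ := net.β_pos j
  have h1 : net.D j * (net.whi i - |(z t).w j - (z t).w i|) ≤ net.D j * (z t).w j :=
    mul_le_mul_of_nonneg_left (by linarith [neg_abs_le ((z t).w j - (z t).w i), hge t ht])
      (net.D_pos j).le
  have h2 : -((net.Phi j - net.Plo j) / κ j *
      ((net.β j)⁻¹ * |(net.field (z t)).w j| + |(z t).w j - (z t).w i|)) ≤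
      net.curtailment (z t) j := by
    rcases lt_or_ge (net.curtailment (z t) j) 0 with hneg | hnn
    · have hv := field_w_eq_of_Pg_eq_lTilde
        (Pg_eq_lTilde_of_curtailment_neg (hz.mem t hd) (hf t hd j) hneg)
      -- Negative curtailment means `v j = β (wlo j - w j)`, so the gap must be covered by the
      -- acceleration of area `j` and its distance from `w i`. Scaling by capacity range over `κ j`
      -- makes this mean-null quantity dominate the curtailment.
      have hk : κ j ≤ (net.β j)⁻¹ * |(net.field (z t)).w j| + |(z t).w j - (z t).w i| := by
        rw [hv, abs_mul, abs_of_pos hβ, inv_mul_cancel_left₀ hβ.ne']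
        simp only [κ]
        linarith [neg_abs_le (net.wlo j - (z t).w j), neg_abs_le ((z t).w j - (z t).w i), hge t ht]
      have hm := mul_le_mul_of_nonneg_left hk (div_nonneg (hP j) (hκ j).le)
      rw [div_mul_cancel₀ _ (hκ j).ne'] at hm
      linarith [(abs_le.1 (abs_curtailment_le (hz.mem t hd) (hf t hd j))).1]
    · have : 0 ≤ (net.Phi j - net.Plo j) / κ j *
          ((net.β j)⁻¹ * |(net.field (z t)).w j| + |(z t).w j - (z t).w i|) :=
        mul_nonneg (div_nonneg (hP j) (hκ j).le) (by positivity)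
      linarith
  linarith

/-- Mirror image of `exists_w_le_whi` with `σ = -1`: positive curtailment now plays the adverse
role. -/
theorem exists_wlo_le_w (hz : net.IsCaratheodorySolution ⊤ z)
    (hf : net.CorrectorFeasibleAlong ⊤ z) (hD : net.DispatchFeasible) (i : Fin (n + 1)) :
    ∃ t, 0 ≤ t ∧ net.wlo i ≤ (z t).w i := by
  by_contra! hgt
  let κ : Fin (n + 1) → ℝ := fun j => net.whi j - net.wlo i
  have hκ : ∀ j, 0 < κ j := fun j => sub_pos.2 ((net.wlo_neg i).trans (net.whi_pos j))
  have hge : ∀ t, 0 ≤ t → (z t).w i ≤ net.wlo i := fun t ht => (hgt t ht).le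
  have hP : ∀ j, 0 ≤ net.Phi j - net.Plo j := fun j =>
    (abs_nonneg _).trans (abs_curtailment_le (hz.mem 0 (mem_timeDomain_top le_rfl))
      (hf 0 (mem_timeDomain_top le_rfl) j))
  refine hz.not_le_sum_damping_add_curtailment hf hD (c := ∑ j, net.D j * -net.wlo i) (σ := -1)
    (g := fun t => ∑ j, (net.D j * |(z t).w j - (z t).w i| + (net.Phi j - net.Plo j) / κ j *
      ((net.β j)⁻¹ * |(net.field (z t)).w j| + |(z t).w j - (z t).w i|)))
    (Finset.sum_pos (fun j _ => mul_pos (net.D_pos j) (neg_pos.2 (net.wlo_neg i)))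
      Finset.univ_nonempty)
    (IsMeanNull.sum _ fun j _ => ((hz.isMeanNull_w_sub hf j i).abs.const_mul _).add
      ((((hz.isMeanNull_field_w hf j).abs.const_mul _).add
        (hz.isMeanNull_w_sub hf j i).abs).const_mul _)) fun t ht => ?_
  rw [neg_one_mul, ← Finset.sum_sub_distrib, ← Finset.sum_neg_distrib]
  refine Finset.sum_le_sum fun j _ => ?_
  have hd := mem_timeDomain_top ht
  have hβ := net.β_pos j
  have h1 : net.D j * (z t).w j ≤ net.D j * (net.wlo i + |(z t).w j - (z t).w i|) :=
    mul_le_mul_of_nonneg_left (by linarith [le_abs_self ((z t).w j - (z t).w i), hge t ht])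
      (net.D_pos j).le
  have h2 : net.curtailment (z t) j ≤ (net.Phi j - net.Plo j) / κ j *
      ((net.β j)⁻¹ * |(net.field (z t)).w j| + |(z t).w j - (z t).w i|) := by
    rcases lt_or_ge 0 (net.curtailment (z t) j) with hpos | hnn
    · have hv := field_w_eq_of_Pg_eq_uTilde
        (Pg_eq_uTilde_of_curtailment_pos (hz.mem t hd) (hf t hd j) hpos)
      have hk : κ j ≤ (net.β j)⁻¹ * |(net.field (z t)).w j| + |(z t).w j - (z t).w i| := by
        rw [hv, abs_mul, abs_of_pos hβ, inv_mul_cancel_left₀ hβ.ne']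
        simp only [κ]
        linarith [le_abs_self (net.whi j - (z t).w j), le_abs_self ((z t).w j - (z t).w i), hge t ht]
      have hm := mul_le_mul_of_nonneg_left hk (div_nonneg (hP j) (hκ j).le)
      rw [div_mul_cancel₀ _ (hκ j).ne'] at hm
      linarith [(abs_le.1 (abs_curtailment_le (hz.mem t hd) (hf t hd j))).2]
    · exact hnn.trans (mul_nonneg (div_nonneg (hP j) (hκ j).le) (by positivity))
  linarith

theorem exists_mem_safeSet (hz : net.IsCaratheodorySolution ⊤ z)
    (hf : net.CorrectorFeasibleAlong ⊤ z) (hD : net.DispatchFeasible) (i : Fin (n + 1)) :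
    ∃ t₁ : ℝ, 0 < t₁ ∧ ∀ t, t₁ ≤ t → (z t).w i ∈ net.safeSet i := by
  obtain ⟨r, hr, hr'⟩ := hz.exists_w_le_whi hf hD i
  obtain ⟨s, hs, hs'⟩ := hz.exists_wlo_le_w hf hD i
  -- Each one-sided bound persists once attained; adding `1` makes the time positive.
  refine ⟨max r s + 1, by linarith [le_max_left r s], fun t ht => ⟨?_, ?_⟩⟩
  · have hst := (le_max_right r s).trans ((lt_add_one _).le.trans ht)
    exact (le_min hs' le_rfl).trans
      (min_le_w hz hf i hs hst (mem_timeDomain_top (hs.trans hst)))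
  · have hrt := (le_max_left r s).trans ((lt_add_one _).le.trans ht)
    exact (w_le_max hz hf i hr hrt (mem_timeDomain_top (hr.trans hrt))).trans
      (max_le hr' le_rfl)

end IsCaratheodorySolution

end PowerNetwork

theorem mainTheorem2 {n : ℕ} (net : PowerNetwork n) (T : EReal) (hT : 0 < T)
    (z : ℝ → GridState n) (hz : net.IsCaratheodorySolution T z)
    (hfeas : net.CorrectorFeasibleAlong T z) (i : Fin (n + 1)) :
    ((z 0).w i ∈ net.safeSet i → ∀ t ∈ timeDomain T, 0 < t → (z t).w i ∈ net.safeSet i) ∧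
    ((z 0).w i ∉ net.safeSet i →
      AntitoneOn (fun t => Metric.infDist ((z t).w i) (net.safeSet i)) (timeDomain T) ∧
      (net.whi i < (z 0).w i →
        AntitoneOn (fun t => (z t).w i) {t ∈ timeDomain T | (z t).w i ∉ net.safeSet i}) ∧
      ((z 0).w i < net.wlo i →
        MonotoneOn (fun t => (z t).w i) {t ∈ timeDomain T | (z t).w i ∉ net.safeSet i}) ∧
      (net.DispatchFeasible → T = ⊤ →
        ∃ t₁ : ℝ, 0 < t₁ ∧ ∀ t, t₁ ≤ t → (z t).w i ∈ net.safeSet i)) := by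
  refine ⟨fun h t ht _ => PowerNetwork.mem_safeSet_of_mem hz hfeas i le_rfl ht.1 ht h, fun _ =>
    ⟨PowerNetwork.antitoneOn_infDist_safeSet hz hfeas i, PowerNetwork.antitoneOn_w hz hfeas i,
      PowerNetwork.monotoneOn_w hz hfeas i, fun hD hT' => ?_⟩⟩
  subst hT'
  exact hz.exists_mem_safeSet hfeas hD i
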